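/- Let $\mathbb K=\mathbb C$ (or $\mathbb R$), let $n\ge 1$, and let $(\mathcal P^k(n),\Delta_k)_{k\ge 0}$ be the Monster (Semple) tower over $\mathbb K^n$: $\mathcal P^0(n)=\mathbb K^n$ with $\Delta_0=T\mathbb K^n$, and $(\mathcal P^{k+1}(n),\Delta_{k+1})$ is the prolongation of $(\mathcal P^k(n),\Delta_k)$. Here the prolongation of an analytic manifold $Z$ with an analytic distribution $D$ is the manifold $\mathbb P D$ of pairs $(z,\ell)$, $z\in Z$, $\ell\subset D(z)$ a line, with projection $\pi:\mathbb PD\to Z$ and the distribution $D^1(z,\ell)=d\pi_{(z,\ell)}^{-1}(\ell)$. The prolongation of an analytic curve germ $c$ at $0$ in $Z$, non-constant and tangent to $D$, is the curve germ $c^1$ in $\mathbb PD$ with $c^1(t)=(c(t),\operatorname{span} c'(t))$ for $t\ne 0$ and $c^1(0)=\lim_{t\to 0}c^1(t)$; $\gamma^k$ denotes the $k$-fold prolongation of a non-constant analytic curve germ $\gamma$ in $\mathbb K^n$. For a submanifold $S$ of $\mathcal P^k(n)$ put $S^1=\{(q,\ell)\in\mathcal P^{k+1}(n): q\in S,\ \ell\subset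 \Delta_k(q)\cap T_qS\}$. For a fibre $F$ of a projection $\mathcal P^{i}(n)\to\mathcal P^{i-1}(n)$, $i\ge 1$, let $\mathcal P^0(F)=F$ and $\mathcal P^{j+1}(F)=(\mathcal P^j(F))^1\subset\mathcal P^{i+j+1}(n)$. A critical hyperplane through a point $p\in\mathcal P^k(n)$ is a subspace of $\Delta_k(p)$ of the form $\Delta_k(p)\cap T_p\mathcal P^j(F)$, where $F$ is a fibre at level $i\ge1$, $i+j=k$, and $p\in\mathcal P^j(F)$. The embedding dimension of a curve germ in $\mathbb K^n$ is the smallest $d$ such that the germ lies in a $d$-dimensional analytic submanifold of $\mathbb K^n$. Theorem. Let $d\ge 1$, $k\ge 0$, and let $\zeta=(p,\ell)$ be a point of $\mathcal P^{k+1}(n)$, $p\in\mathcal P^k(n)$, whose line $\ell\subset\Delta_k(p)$ lies in $d-1$ distinct critical hyperplanes through $p$. Then there is no analytic curve germ $\gamma$ at $0$ in $\mathbb K^n$ of embedding dimension less than $d$ with $\gamma^{k+1}(0)=\zeta$. -/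

import Mathlib

open scoped Manifold ContDiff Topology

noncomputable section

universe u

/-- An analytic manifold over `𝕜` (`ℝ` or `ℂ`) with an analytic distribution `D` of rank `m + 1`.
The distribution is presented in the preferred charts by analytic frames `X` with dual coframes
`θ`: over the domain of the chart at `w`, the columns of `X w` span `D`. -/
structure DistManifold (𝕜 : Type u) [RCLike 𝕜] (m : ℕ) where
  Pt : Type u
  E : Type u
  [normE : NormedAddCommGroup E]
  [spaceE : NormedSpace 𝕜 E]
  [finE : FiniteDimensional 𝕜 E]
  [topPt : TopologicalSpace Pt]
  [charted : ChartedSpace E Pt]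
  [manifold : IsManifold 𝓘(𝕜, E) ω Pt]
  D : Pt → Submodule 𝕜 E
  X : Pt → E → ((Fin (m + 1) → 𝕜) →L[𝕜] E)
  θ : Pt → E → (E →L[𝕜] (Fin (m + 1) → 𝕜))
  X_analytic : ∀ w, ContDiffOn 𝕜 ω (X w) (chartAt E w).target
  θ_analytic : ∀ w, ContDiffOn 𝕜 ω (θ w) (chartAt E w).target
  θ_X : ∀ w, ∀ y ∈ (chartAt E w).target, ∀ ξ, θ w y (X w y ξ) = ξ
  D_eq : ∀ w z : Pt, z ∈ (chartAt E w).source →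
    (D z).map (tangentCoordChange 𝓘(𝕜, E) z w z : E →ₗ[𝕜] E) =
      LinearMap.range (X w (chartAt E w z) : (Fin (m + 1) → 𝕜) →ₗ[𝕜] E)

namespace DistManifold

attribute [instance] normE spaceE finE topPt charted manifold

variable {𝕜 : Type u} [RCLike 𝕜] {m : ℕ}

/-- A point `(z, ℓ)` of `ℙ D`: a point `z` and a line `ℓ ⊆ D z`. -/
@[ext]
structure LinePt (M : DistManifold 𝕜 m) where
  base : M.Pt
  line : Submodule 𝕜 M.E
  line_le : line ≤ M.D base
  finrank_line : Module.finrank 𝕜 line = 1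

variable (M : DistManifold 𝕜 m)

/-- Tangent vectors at `z`, read in the chart at `w`. -/
def toChart (w z : M.Pt) : M.E →L[𝕜] M.E := tangentCoordChange 𝓘(𝕜, M.E) z w z

/-- Tangent vectors at `z`, from their coordinates in the chart at `w`. -/
def ofChart (w z : M.Pt) : M.E →L[𝕜] M.E := tangentCoordChange 𝓘(𝕜, M.E) w z z

variable {M}

theorem ofChart_toChart {w z : M.Pt} (h : z ∈ (chartAt M.E w).source) (v : M.E) :
    M.ofChart w z (M.toChart w z v) = v := by
  unfold ofChart toChart
  rw [tangentCoordChange_comp, tangentCoordChange_self] <;> simp [h]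

theorem toChart_ofChart {w z : M.Pt} (h : z ∈ (chartAt M.E w).source) (v : M.E) :
    M.toChart w z (M.ofChart w z v) = v := by
  unfold ofChart toChart
  rw [tangentCoordChange_comp, tangentCoordChange_self] <;> simp [h]

/-- The frame coordinates, in the chart at `w`, of a tangent vector at `z`. -/
def frameCoord (w z : M.Pt) (v : M.E) : Fin (m + 1) → 𝕜 :=
  M.θ w (chartAt M.E w z) (M.toChart w z v)

/-- The vector of `D z` with given frame coordinates in the chart at `w`. -/
def frameVec (w z : M.Pt) (ξ : Fin (m + 1) → 𝕜) : M.E :=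
  M.ofChart w z (M.X w (chartAt M.E w z) ξ)

theorem frameVec_mem {w z : M.Pt} (h : z ∈ (chartAt M.E w).source) (ξ : Fin (m + 1) → 𝕜) :
    frameVec w z ξ ∈ M.D z := by
  have : M.X w (chartAt M.E w z) ξ ∈
      (M.D z).map (tangentCoordChange 𝓘(𝕜, M.E) z w z : M.E →ₗ[𝕜] M.E) := by
    rw [M.D_eq w z h]; exact ⟨ξ, rfl⟩
  obtain ⟨v, hv, hv'⟩ := this
  have h2 : M.toChart w z v = M.X w (chartAt M.E w z) ξ := hv'
  unfold frameVec
  rw [← h2]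
  erw [ofChart_toChart h]
  exact hv

theorem frameCoord_frameVec {w z : M.Pt} (h : z ∈ (chartAt M.E w).source)
    (ξ : Fin (m + 1) → 𝕜) : frameCoord w z (frameVec w z ξ) = ξ := by
  unfold frameCoord frameVec
  rw [toChart_ofChart h, M.θ_X w _ ((chartAt M.E w).map_source h)]

theorem frameVec_frameCoord {w z : M.Pt} (h : z ∈ (chartAt M.E w).source)
    {v : M.E} (hv : v ∈ M.D z) : frameVec w z (frameCoord w z v) = v := by
  have : M.toChart w z v ∈ LinearMap.range
      (M.X w (chartAt M.E w z) : (Fin (m + 1) → 𝕜) →ₗ[𝕜] M.E) := by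
    rw [← M.D_eq w z h]; exact ⟨v, hv, rfl⟩
  obtain ⟨ξ, hξ⟩ := this
  have h2 : M.X w (chartAt M.E w z) ξ = M.toChart w z v := hξ
  unfold frameCoord frameVec
  rw [← h2, M.θ_X w _ ((chartAt M.E w).map_source h), h2, ofChart_toChart h]

theorem frameCoord_smul (w z : M.Pt) (c : 𝕜) (v : M.E) :
    frameCoord w z (c • v) = c • frameCoord w z v := by
  simp [frameCoord]

theorem frameVec_smul (w z : M.Pt) (c : 𝕜) (ξ : Fin (m + 1) → 𝕜) :
    frameVec w z (c • ξ) = c • frameVec w z ξ := by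
  simp [frameVec]

namespace LinePt

theorem exists_gen (p : LinePt M) :
    ∃ v : M.E, v ≠ 0 ∧ p.line = Submodule.span 𝕜 {v} := by
  obtain ⟨v, hv, h⟩ := finrank_eq_one_iff'.1 p.finrank_line
  refine ⟨(v : M.E), fun h0 => hv (Subtype.ext h0), ?_⟩
  apply le_antisymm
  · intro x hx
    obtain ⟨c, hc⟩ := h ⟨x, hx⟩
    exact Submodule.mem_span_singleton.2 ⟨c, congrArg Subtype.val hc⟩
  · exact (Submodule.span_singleton_le_iff_mem _ _).2 v.2

/-- A vector spanning the line of `p`. -/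
def gen (p : LinePt M) : M.E := Classical.choose p.exists_gen

theorem gen_ne (p : LinePt M) : p.gen ≠ 0 := (Classical.choose_spec p.exists_gen).1

theorem line_eq (p : LinePt M) : p.line = Submodule.span 𝕜 {p.gen} :=
  (Classical.choose_spec p.exists_gen).2

theorem gen_mem (p : LinePt M) : p.gen ∈ M.D p.base := by
  apply p.line_le
  rw [p.line_eq]
  exact Submodule.mem_span_singleton_self _

/-- The point of `ℙ D` over `z` whose line is spanned by the nonzero vector `v` of `D z`. -/
def mk' (z : M.Pt) (v : M.E) (hv : v ∈ M.D z) (h0 : v ≠ 0) : LinePt M where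
  base := z
  line := Submodule.span 𝕜 {v}
  line_le := (Submodule.span_singleton_le_iff_mem _ _).2 hv
  finrank_line := finrank_span_singleton h0


theorem ext_of_gen {p q : LinePt M} (hb : p.base = q.base) (c : 𝕜) (hc : c ≠ 0)
    (h : p.gen = c • q.gen) : p = q :=
  LinePt.ext hb (by
    rw [p.line_eq, q.line_eq, h, Submodule.span_singleton_smul_eq (IsUnit.mk0 c hc)])

theorem gen_mk' (z : M.Pt) (v : M.E) (hv : v ∈ M.D z) (h0 : v ≠ 0) :
    ∃ c : 𝕜, c ≠ 0 ∧ (mk' z v hv h0).gen = c • v := by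
  have h1 : (mk' z v hv h0).gen ∈ (mk' z v hv h0).line := by
    rw [(mk' z v hv h0).line_eq]; exact Submodule.mem_span_singleton_self _
  obtain ⟨c, hc⟩ := Submodule.mem_span_singleton.1 h1
  refine ⟨c, ?_, hc.symm⟩
  rintro rfl
  exact (mk' z v hv h0).gen_ne (by rw [← hc]; exact zero_smul 𝕜 v)

end LinePt

/-- `(u_1, …, u_m) ↦ (u_1, …, 1, …, u_m)`, the entry `1` being in position `a`. -/
def ins (a : Fin (m + 1)) (u : Fin m → 𝕜) : Fin (m + 1) → 𝕜 :=
  a.insertNth (α := fun _ => 𝕜) 1 u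

/-- The affine coordinates of the point `[ξ]` of projective space where `ξ a ≠ 0`. -/
def slope (a : Fin (m + 1)) (ξ : Fin (m + 1) → 𝕜) : Fin m → 𝕜 :=
  fun i => ξ (a.succAbove i) / ξ a

@[simp] theorem ins_self (a : Fin (m + 1)) (u : Fin m → 𝕜) : ins a u a = 1 := by
  simp [ins]

@[simp] theorem ins_succAbove (a : Fin (m + 1)) (u : Fin m → 𝕜) (i : Fin m) :
    ins a u (a.succAbove i) = u i := by
  simp [ins]

theorem ins_ne_zero (a : Fin (m + 1)) (u : Fin m → 𝕜) : ins a u ≠ 0 := fun h => by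
  simpa using congrFun h a

theorem slope_ins (a : Fin (m + 1)) (u : Fin m → 𝕜) : slope a (ins a u) = u := by
  ext i; simp [slope]

theorem slope_smul (a : Fin (m + 1)) {c : 𝕜} (hc : c ≠ 0) (ξ : Fin (m + 1) → 𝕜) :
    slope a (c • ξ) = slope a ξ := by
  ext i; simp [slope, mul_div_mul_left _ _ hc]

theorem ins_slope (a : Fin (m + 1)) {ξ : Fin (m + 1) → 𝕜} (h : ξ a ≠ 0) :
    ins a (slope a ξ) = (ξ a)⁻¹ • ξ := by
  ext j
  rcases Fin.eq_self_or_eq_succAbove a j with rfl | ⟨i, rfl⟩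
  · simp [h]
  · simp [slope, div_eq_inv_mul]

theorem contDiff_ins (a : Fin (m + 1)) : ContDiff 𝕜 ω (ins (𝕜 := 𝕜) a) := by
  rw [contDiff_pi]
  intro j
  rcases Fin.eq_self_or_eq_succAbove a j with rfl | ⟨i, rfl⟩
  · simpa using contDiff_const
  · simpa using contDiff_apply 𝕜 𝕜 i

theorem contDiffOn_slope (a : Fin (m + 1)) :
    ContDiffOn 𝕜 ω (slope (𝕜 := 𝕜) a) {ξ | ξ a ≠ 0} := by
  rw [contDiffOn_pi]
  intro i
  exact (contDiff_apply 𝕜 𝕜 _).contDiffOn.div (contDiff_apply 𝕜 𝕜 _).contDiffOn fun _ h => h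

theorem frameVec_ne_zero {w z : M.Pt} (h : z ∈ (chartAt M.E w).source) {ξ : Fin (m + 1) → 𝕜}
    (hξ : ξ ≠ 0) : frameVec w z ξ ≠ 0 := fun h0 => hξ <| by
  rw [← frameCoord_frameVec h ξ, h0]; simp [frameCoord]

theorem frameCoord_ne_zero {w z : M.Pt} (h : z ∈ (chartAt M.E w).source) {v : M.E}
    (hv : v ∈ M.D z) (h0 : v ≠ 0) : frameCoord w z v ≠ 0 := fun h1 => h0 <| by
  rw [← frameVec_frameCoord h hv, h1]; simp [frameVec]

/-- The point of `ℙ D` over `z` with affine coordinates `u` in the `a`-th affine chart of the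
fibre, with respect to the frame over the chart at `w`. -/
def pointOf (w : M.Pt) (a : Fin (m + 1)) (z : M.Pt) (h : z ∈ (chartAt M.E w).source)
    (u : Fin m → 𝕜) : LinePt M :=
  LinePt.mk' z (frameVec w z (ins a u)) (frameVec_mem h _) (frameVec_ne_zero h (ins_ne_zero a u))

theorem gen_pointOf (w : M.Pt) (a : Fin (m + 1)) (z : M.Pt) (h : z ∈ (chartAt M.E w).source)
    (u : Fin m → 𝕜) : ∃ c : 𝕜, c ≠ 0 ∧
      (pointOf w a z h u).gen = c • frameVec w z (ins a u) :=
  LinePt.gen_mk' _ _ _ _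

open Classical in
/-- The affine chart of `ℙ D` attached to the chart of the base at `w` and to `a`. -/
def lineChart (w : M.Pt) (a : Fin (m + 1)) : PartialEquiv (LinePt M) (M.E × (Fin m → 𝕜)) where
  toFun p := (chartAt M.E w p.base, slope a (frameCoord w p.base p.gen))
  invFun q := if h : (chartAt M.E w).symm q.1 ∈ (chartAt M.E w).source then
    pointOf w a ((chartAt M.E w).symm q.1) h q.2 else
    pointOf w a w (mem_chart_source M.E w) q.2
  source := {p | p.base ∈ (chartAt M.E w).source ∧ frameCoord w p.base p.gen a ≠ 0}
  target := {q | q.1 ∈ (chartAt M.E w).target}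
  map_source' p hp := (chartAt M.E w).map_source hp.1
  map_target' q hq := by
    have hz := (chartAt M.E w).map_target hq
    rw [dif_pos hz]
    refine ⟨hz, ?_⟩
    obtain ⟨c, hc, h⟩ := gen_pointOf w a _ hz q.2
    rw [h]
    change frameCoord w ((chartAt M.E w).symm q.1) _ a ≠ 0
    rw [frameCoord_smul, frameCoord_frameVec hz]
    simpa using hc
  left_inv' p hp := by
    have hz : (chartAt M.E w).symm (chartAt M.E w p.base) = p.base :=
      (chartAt M.E w).left_inv hp.1
    simp only [hz, hp.1, dif_pos]
    obtain ⟨c, hc, h⟩ := gen_pointOf w a _ hp.1 (slope a (frameCoord w p.base p.gen))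
    refine LinePt.ext_of_gen rfl (c * (frameCoord w p.base p.gen a)⁻¹)
      (mul_ne_zero hc (inv_ne_zero hp.2)) ?_
    rw [h, ins_slope a hp.2, frameVec_smul, frameVec_frameCoord hp.1 p.gen_mem, smul_smul]
  right_inv' q hq := by
    have hz := (chartAt M.E w).map_target hq
    rw [dif_pos hz]
    obtain ⟨c, hc, h⟩ := gen_pointOf w a _ hz q.2
    refine Prod.ext ((chartAt M.E w).right_inv hq) ?_
    change slope a (frameCoord w ((chartAt M.E w).symm q.1) (pointOf w a _ hz q.2).gen) = q.2
    rw [h, frameCoord_smul, frameCoord_frameVec hz, slope_smul a hc, slope_ins]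

theorem lineChart_symm_eq {w : M.Pt} {a : Fin (m + 1)} {q : M.E × (Fin m → 𝕜)}
    (hq : q.1 ∈ (chartAt M.E w).target) :
    (lineChart w a).symm q =
      pointOf w a ((chartAt M.E w).symm q.1) ((chartAt M.E w).map_target hq) q.2 :=
  dif_pos _

/-- The change of frame coordinates, at the point with coordinate `y` in the chart at `w`, from
the chart at `w` to the chart at `w'`. -/
def frameChange (w w' : M.Pt) (y : M.E) (ξ : Fin (m + 1) → 𝕜) : Fin (m + 1) → 𝕜 :=
  M.θ w' (chartAt M.E w' ((chartAt M.E w).symm y))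
    (tangentCoordChange 𝓘(𝕜, M.E) w w' ((chartAt M.E w).symm y) (M.X w y ξ))

theorem frameCoord_frameVec' {w w' : M.Pt} {y : M.E}
    (h : y ∈ ((chartAt M.E w).symm ≫ₕ chartAt M.E w').source) (ξ : Fin (m + 1) → 𝕜) :
    frameCoord w' ((chartAt M.E w).symm y) (frameVec w ((chartAt M.E w).symm y) ξ) =
      frameChange w w' y ξ := by
  simp only [OpenPartialHomeomorph.trans_source, OpenPartialHomeomorph.symm_source,
    Set.mem_inter_iff, Set.mem_preimage] at h
  have hz := (chartAt M.E w).map_target h.1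
  unfold frameCoord frameVec frameChange toChart ofChart
  rw [tangentCoordChange_comp (by simp [h.2, hz]), (chartAt M.E w).right_inv h.1]

/-- The domain of the change of charts from the chart at `w` to the chart at `w'`. -/
def overlap (w w' : M.Pt) : Set M.E := ((chartAt M.E w).symm ≫ₕ chartAt M.E w').source

theorem isOpen_overlap (w w' : M.Pt) : IsOpen (overlap w w') :=
  ((chartAt M.E w).symm ≫ₕ chartAt M.E w').open_source

theorem mem_overlap {w w' : M.Pt} {y : M.E} : y ∈ overlap w w' ↔
    y ∈ (chartAt M.E w).target ∧ (chartAt M.E w).symm y ∈ (chartAt M.E w').source := by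
  simp [overlap]

theorem contDiffOn_change (w w' : M.Pt) :
    ContDiffOn 𝕜 ω (fun y => chartAt M.E w' ((chartAt M.E w).symm y)) (overlap w w') := by
  have h2 := contDiffOn_ext_coord_change (I := 𝓘(𝕜, M.E)) (n := ω) w' w
  refine (h2.congr fun y _ => ?_).mono fun y hy => ?_
  · simp
  · rw [mem_overlap] at hy
    simpa [PartialEquiv.trans_source] using hy

theorem contDiffOn_frameChange (w w' : M.Pt) :
    ContDiffOn 𝕜 ω (fun q : M.E × (Fin (m + 1) → 𝕜) => frameChange w w' q.1 q.2)
      (overlap w w' ×ˢ Set.univ) := by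
  have hI : IsManifold 𝓘(𝕜, M.E) (ω + 1) M.Pt := M.manifold
  have h1 := contDiffOn_fderiv_coord_change (I := 𝓘(𝕜, M.E)) (n := ω)
    (achart M.E w) (achart M.E w')
  have h1' : ContDiffOn 𝕜 ω
      (fun y => tangentCoordChange 𝓘(𝕜, M.E) w w' ((chartAt M.E w).symm y)) (overlap w w') := by
    refine (h1.congr fun y hy => ?_).mono fun y hy => ?_
    · rw [tangentCoordChange_def]
      have : y ∈ (chartAt M.E w).target := by
        simp only [PartialEquiv.trans_source] at hy
        simpa using hy.1
      simp only [extChartAt, mfld_simps]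
      rw [(chartAt M.E w).right_inv this]
    · rw [mem_overlap] at hy
      simpa [PartialEquiv.trans_source] using hy
  have hf : ContDiffOn 𝕜 ω (Prod.fst : M.E × (Fin (m + 1) → 𝕜) → M.E)
      (overlap w w' ×ˢ Set.univ) := contDiffOn_fst
  have m1 : Set.MapsTo (Prod.fst : M.E × (Fin (m + 1) → 𝕜) → M.E)
      (overlap w w' ×ˢ Set.univ) (overlap w w') := fun q hq => hq.1
  refine ContDiffOn.clm_apply (((M.θ_analytic w').comp (contDiffOn_change w w') fun y hy => ?_).comp
    hf m1) (ContDiffOn.clm_apply (h1'.comp hf m1)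
      (ContDiffOn.clm_apply ((M.X_analytic w).comp hf fun q hq => ?_) contDiffOn_snd))
  · exact (chartAt M.E w').map_source (mem_overlap.1 hy).2
  · exact (mem_overlap.1 hq.1).1

/-- The frame coordinates, in the chart at `w'`, of the line with affine coordinates `q`. -/
def lineChange (w : M.Pt) (a : Fin (m + 1)) (w' : M.Pt) (q : M.E × (Fin m → 𝕜)) :
    Fin (m + 1) → 𝕜 :=
  frameChange w w' q.1 (ins a q.2)

theorem contDiffOn_lineChange (w : M.Pt) (a : Fin (m + 1)) (w' : M.Pt) :
    ContDiffOn 𝕜 ω (lineChange w a w') (overlap w w' ×ˢ Set.univ) :=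
  (contDiffOn_frameChange w w').comp
    (contDiffOn_fst.prodMk ((contDiff_ins a).comp_contDiffOn contDiffOn_snd))
    fun _ hq => ⟨hq.1, trivial⟩

theorem lineChart_trans_source (w : M.Pt) (a : Fin (m + 1)) (w' : M.Pt) (a' : Fin (m + 1)) :
    ((lineChart w a).symm.trans (lineChart w' a')).source =
      (overlap w w' ×ˢ Set.univ) ∩ lineChange w a w' ⁻¹' {ξ | ξ a' ≠ 0} := by
  ext q
  simp only [PartialEquiv.trans_source, Set.mem_inter_iff, Set.mem_preimage, Set.mem_prod,
    Set.mem_univ, and_true, mem_overlap]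
  change (q.1 ∈ (chartAt M.E w).target ∧ (lineChart w a).symm q ∈ (lineChart w' a').source) ↔ _
  constructor
  · rintro ⟨h1, h2⟩
    rw [lineChart_symm_eq h1] at h2
    obtain ⟨c, hc, h⟩ := gen_pointOf w a _ ((chartAt M.E w).map_target h1) q.2
    obtain ⟨h3, h4⟩ := h2
    refine ⟨⟨h1, h3⟩, fun h0 => h4 ?_⟩
    rw [h]
    change frameCoord w' ((chartAt M.E w).symm q.1) _ a' = 0
    rw [frameCoord_smul, frameCoord_frameVec' (mem_overlap.2 ⟨h1, h3⟩)]
    change c • (lineChange w a w' q a') = 0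
    rw [h0, smul_zero]
  · rintro ⟨⟨h1, h3⟩, h4⟩
    refine ⟨h1, ?_⟩
    rw [lineChart_symm_eq h1]
    obtain ⟨c, hc, h⟩ := gen_pointOf w a _ ((chartAt M.E w).map_target h1) q.2
    refine ⟨h3, ?_⟩
    rw [h]
    change frameCoord w' ((chartAt M.E w).symm q.1) _ a' ≠ 0
    rw [frameCoord_smul, frameCoord_frameVec' (mem_overlap.2 ⟨h1, h3⟩)]
    exact mul_ne_zero hc h4

theorem lineChart_trans_eq {w : M.Pt} {a : Fin (m + 1)} {w' : M.Pt} {a' : Fin (m + 1)}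
    {q : M.E × (Fin m → 𝕜)} (hq : q.1 ∈ overlap w w') :
    lineChart w' a' ((lineChart w a).symm q) =
      (chartAt M.E w' ((chartAt M.E w).symm q.1), slope a' (lineChange w a w' q)) := by
  have h1 := (mem_overlap.1 hq).1
  rw [lineChart_symm_eq h1]
  obtain ⟨c, hc, h⟩ := gen_pointOf w a _ ((chartAt M.E w).map_target h1) q.2
  refine Prod.ext rfl ?_
  change slope a' (frameCoord w' ((chartAt M.E w).symm q.1) (pointOf w a _ _ q.2).gen) = _
  rw [h, frameCoord_smul, frameCoord_frameVec' hq, slope_smul a' hc]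
  rfl

theorem isOpen_lineChart_trans_source (w : M.Pt) (a : Fin (m + 1)) (w' : M.Pt)
    (a' : Fin (m + 1)) : IsOpen ((lineChart w a).symm.trans (lineChart w' a')).source := by
  rw [lineChart_trans_source]
  refine (contDiffOn_lineChange w a w').continuousOn.isOpen_inter_preimage
    ((isOpen_overlap w w').prod isOpen_univ) ?_
  exact isOpen_ne.preimage (continuous_apply a')

theorem contDiffOn_lineChart_trans (w : M.Pt) (a : Fin (m + 1)) (w' : M.Pt)
    (a' : Fin (m + 1)) : ContDiffOn 𝕜 ω ((lineChart w a).symm.trans (lineChart w' a'))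
      ((lineChart w a).symm.trans (lineChart w' a')).source := by
  rw [lineChart_trans_source]
  have : ContDiffOn 𝕜 ω (fun q : M.E × (Fin m → 𝕜) =>
      (chartAt M.E w' ((chartAt M.E w).symm q.1), slope a' (lineChange w a w' q)))
      ((overlap w w' ×ˢ Set.univ) ∩ lineChange w a w' ⁻¹' {ξ | ξ a' ≠ 0}) :=
    ((contDiffOn_change w w').comp contDiffOn_fst fun q hq => hq.1.1).prodMk
      ((contDiffOn_slope a').comp ((contDiffOn_lineChange w a w').mono Set.inter_subset_left)
        fun q hq => hq.2)
  exact this.congr fun q hq => lineChart_trans_eq hq.1.1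

theorem exists_index (p : LinePt M) :
    ∃ a : Fin (m + 1), frameCoord p.base p.base p.gen a ≠ 0 :=
  Function.ne_iff.1 (frameCoord_ne_zero (mem_chart_source M.E p.base) p.gen_mem p.gen_ne)

/-- An index of an affine chart around the line of `p`. -/
def index (p : LinePt M) : Fin (m + 1) := Classical.choose (exists_index p)

theorem mem_lineChart_source (p : LinePt M) : p ∈ (lineChart p.base (index p)).source :=
  ⟨mem_chart_source M.E p.base, Classical.choose_spec (exists_index p)⟩

/-- The atlas of `ℙ D`. -/
def lineCore (M : DistManifold 𝕜 m) : ChartedSpaceCore (M.E × (Fin m → 𝕜)) (LinePt M) where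
  atlas := {e | ∃ w a, e = lineChart w a}
  chartAt p := lineChart p.base (index p)
  mem_chart_source := mem_lineChart_source
  chart_mem_atlas p := ⟨_, _, rfl⟩
  open_source := by
    rintro _ _ ⟨w, a, rfl⟩ ⟨w', a', rfl⟩
    exact isOpen_lineChart_trans_source w a w' a'
  continuousOn_toFun := by
    rintro _ _ ⟨w, a, rfl⟩ ⟨w', a', rfl⟩
    exact (contDiffOn_lineChart_trans w a w' a').continuousOn

instance : TopologicalSpace (LinePt M) := (lineCore M).toTopologicalSpace

instance : ChartedSpace (M.E × (Fin m → 𝕜)) (LinePt M) := (lineCore M).toChartedSpace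

instance : IsManifold 𝓘(𝕜, M.E × (Fin m → 𝕜)) ω (LinePt M) := by
  refine isManifold_of_contDiffOn _ _ _ ?_
  intro e e' he he'
  simp only [atlas, ChartedSpace.atlas, Set.mem_iUnion, Set.mem_singleton_iff] at he he'
  obtain ⟨_, ⟨w, a, rfl⟩, rfl⟩ := he
  obtain ⟨_, ⟨w', a', rfl⟩, rfl⟩ := he'
  simp only [modelWithCornersSelf_coe, modelWithCornersSelf_coe_symm, Set.range_id,
    Set.inter_univ, Set.preimage_id, Function.id_comp, Function.comp_id]
  exact contDiffOn_lineChart_trans w a w' a'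

theorem lineChart_symm_base {w : M.Pt} {a : Fin (m + 1)} {q : M.E × (Fin m → 𝕜)}
    (hq : q.1 ∈ (chartAt M.E w).target) :
    ((lineChart w a).symm q).base = (chartAt M.E w).symm q.1 := by
  rw [lineChart_symm_eq hq]; rfl

theorem target_mem_nhds (p : LinePt M) :
    {q : M.E × (Fin m → 𝕜) | q.1 ∈ (chartAt M.E p.base).target} ∈
      𝓝 (lineChart p.base (index p) p) :=
  ((chartAt M.E p.base).open_target.preimage continuous_fst).mem_nhds
    ((chartAt M.E p.base).map_source (mem_chart_source M.E p.base))

/-- In the preferred charts, the differential of the projection `ℙ D → Z` is the first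
projection. -/
theorem hasMFDerivAt_base (p : LinePt M) :
    HasMFDerivAt 𝓘(𝕜, M.E × (Fin m → 𝕜)) 𝓘(𝕜, M.E) (LinePt.base : LinePt M → M.Pt) p
      (ContinuousLinearMap.fst 𝕜 M.E (Fin m → 𝕜)) := by
  have hs : (chartAt (M.E × (Fin m → 𝕜)) p).source ∈ 𝓝 p := chart_source_mem_nhds _ p
  refine ⟨?_, ?_⟩
  · have h1 : ContinuousAt (fun x : LinePt M =>
        (chartAt M.E p.base).symm (chartAt (M.E × (Fin m → 𝕜)) p x).1) p := by
      have h2 := (chartAt (M.E × (Fin m → 𝕜)) p).continuousAt (mem_chart_source _ p)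
      refine ContinuousAt.comp (f := fun x : LinePt M => (chartAt (M.E × (Fin m → 𝕜)) p x).1)
        ?_ (continuous_fst.continuousAt.comp h2)
      exact (chartAt M.E p.base).continuousAt_symm
        ((chartAt M.E p.base).map_source (mem_chart_source M.E p.base))
    refine h1.congr ?_
    filter_upwards [hs] with x hx
    exact (chartAt M.E p.base).left_inv hx.1
  · refine (ContinuousLinearMap.fst 𝕜 M.E (Fin m → 𝕜)).hasFDerivAt.hasFDerivWithinAt.congr_of_eventuallyEq
      (mem_nhdsWithin_of_mem_nhds ?_) ?_
    · filter_upwards [target_mem_nhds p] with q hq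
      change chartAt M.E p.base ((lineChart p.base (index p)).symm q).base = q.1
      rw [lineChart_symm_base hq]
      exact (chartAt M.E p.base).right_inv hq
    · change chartAt M.E p.base ((lineChart p.base (index p)).symm
        (lineChart p.base (index p) p)).base = (lineChart p.base (index p) p).1
      rw [(lineChart p.base (index p)).left_inv (mem_lineChart_source p)]
      rfl

/-- The differential of the projection `ℙ D → Z`. -/
def dproj (p : LinePt M) : M.E × (Fin m → 𝕜) →L[𝕜] M.E :=
  mfderiv 𝓘(𝕜, M.E × (Fin m → 𝕜)) 𝓘(𝕜, M.E) (LinePt.base : LinePt M → M.Pt) p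

theorem dproj_eq (p : LinePt M) : dproj p = ContinuousLinearMap.fst 𝕜 M.E (Fin m → 𝕜) :=
  (hasMFDerivAt_base p).mfderiv

/-- The prolonged distribution `D¹ (z, ℓ) = dπ⁻¹ (ℓ)`, `π` being the projection `ℙ D → Z`. -/
def lineD (p : LinePt M) : Submodule 𝕜 (M.E × (Fin m → 𝕜)) :=
  p.line.comap (dproj p : M.E × (Fin m → 𝕜) →ₗ[𝕜] M.E)

theorem mem_lineD {p : LinePt M} {v : M.E × (Fin m → 𝕜)} : v ∈ lineD p ↔ v.1 ∈ p.line := by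
  unfold lineD
  rw [dproj_eq]
  rfl

theorem tangentCoordChange_fst {p W : LinePt M}
    (h : p ∈ (chartAt (M.E × (Fin m → 𝕜)) W).source) (v : M.E × (Fin m → 𝕜)) :
    (tangentCoordChange 𝓘(𝕜, M.E × (Fin m → 𝕜)) p W p v).1 = M.toChart W.base p.base v.1 := by
  have h1 := hasFDerivWithinAt_tangentCoordChange (I := 𝓘(𝕜, M.E × (Fin m → 𝕜)))
    (x := p) (y := W) (z := p) (by simpa using h)
  have hb : p.base ∈ (chartAt M.E W.base).source := h.1
  have h2 := hasFDerivWithinAt_tangentCoordChange (I := 𝓘(𝕜, M.E))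
    (x := p.base) (y := W.base) (z := p.base) (by simpa using hb)
  simp only [modelWithCornersSelf_coe, Set.range_id, hasFDerivWithinAt_univ] at h1 h2
  have h3 := hasFDerivAt_fst.comp _ h1
  have h4 := HasFDerivAt.comp (extChartAt 𝓘(𝕜, M.E × (Fin m → 𝕜)) p p)
    (f := (Prod.fst : M.E × (Fin m → 𝕜) → M.E)) h2 hasFDerivAt_fst
  have h5 := h3.unique (h4.congr_of_eventuallyEq ?_)
  · exact DFunLike.congr_fun h5 v
  · filter_upwards [target_mem_nhds p] with q hq
    change chartAt M.E W.base ((lineChart p.base (index p)).symm q).base =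
      chartAt M.E W.base ((chartAt M.E p.base).symm q.1)
    rw [lineChart_symm_base hq]

/-- The frame of `D¹` in an affine chart: in position `a` the lift of the vector of `D` with frame
coordinates `ins a u`, in the other positions the coordinate vector fields of the fibre. -/
def lineX (W : LinePt M) (q : M.E × (Fin m → 𝕜)) :
    (Fin (m + 1) → 𝕜) →L[𝕜] M.E × (Fin m → 𝕜) :=
  ((ContinuousLinearMap.proj (R := 𝕜) (φ := fun _ : Fin (m + 1) => 𝕜) (index W)).smulRight
    (M.X W.base q.1 (ins (index W) q.2))).prod
  (ContinuousLinearMap.pi fun i =>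
    ContinuousLinearMap.proj (R := 𝕜) (φ := fun _ : Fin (m + 1) => 𝕜) ((index W).succAbove i))

/-- The coframe dual to `lineX`. -/
def lineθ (W : LinePt M) (q : M.E × (Fin m → 𝕜)) :
    M.E × (Fin m → 𝕜) →L[𝕜] (Fin (m + 1) → 𝕜) :=
  ContinuousLinearMap.pi ((index W).insertNth
    (α := fun _ => M.E × (Fin m → 𝕜) →L[𝕜] 𝕜)
    ((ContinuousLinearMap.proj (R := 𝕜) (φ := fun _ : Fin (m + 1) => 𝕜) (index W)).comp
      ((M.θ W.base q.1).comp (ContinuousLinearMap.fst 𝕜 M.E (Fin m → 𝕜))))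
    fun i => (ContinuousLinearMap.proj (R := 𝕜) (φ := fun _ : Fin m => 𝕜) i).comp
      (ContinuousLinearMap.snd 𝕜 M.E (Fin m → 𝕜)))

theorem lineX_apply (W : LinePt M) (q : M.E × (Fin m → 𝕜)) (ξ : Fin (m + 1) → 𝕜) :
    lineX W q ξ = (ξ (index W) • M.X W.base q.1 (ins (index W) q.2),
      fun i => ξ ((index W).succAbove i)) := rfl

theorem lineθ_self (W : LinePt M) (q v : M.E × (Fin m → 𝕜)) :
    lineθ W q v (index W) = M.θ W.base q.1 v.1 (index W) := by
  simp [lineθ]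

theorem lineθ_succAbove (W : LinePt M) (q v : M.E × (Fin m → 𝕜)) (i : Fin m) :
    lineθ W q v ((index W).succAbove i) = v.2 i := by
  simp [lineθ]

theorem lineD_eq (W p : LinePt M) (h : p ∈ (chartAt (M.E × (Fin m → 𝕜)) W).source) :
    (lineD p).map (tangentCoordChange 𝓘(𝕜, M.E × (Fin m → 𝕜)) p W p :
        M.E × (Fin m → 𝕜) →ₗ[𝕜] M.E × (Fin m → 𝕜)) =
      LinearMap.range (lineX W (chartAt (M.E × (Fin m → 𝕜)) W p) :
        (Fin (m + 1) → 𝕜) →ₗ[𝕜] M.E × (Fin m → 𝕜)) := by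
  have hb : p.base ∈ (chartAt M.E W.base).source := h.1
  have ha : frameCoord W.base p.base p.gen (index W) ≠ 0 := h.2
  set ξ := frameCoord W.base p.base p.gen with hξ
  have hg : M.toChart W.base p.base p.gen = M.X W.base (chartAt M.E W.base p.base) ξ := by
    conv_lhs => rw [← frameVec_frameCoord hb p.gen_mem]
    unfold frameVec
    rw [toChart_ofChart hb]
  have hq : M.X W.base (chartAt M.E W.base p.base)
      (ins (index W) (slope (index W) ξ)) = (ξ (index W))⁻¹ • M.toChart W.base p.base p.gen := by
    rw [ins_slope _ ha, hg, map_smul]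
  have hX : ∀ η, lineX W (chartAt (M.E × (Fin m → 𝕜)) W p) η =
      ((η (index W) * (ξ (index W))⁻¹) • M.toChart W.base p.base p.gen,
        fun i => η ((index W).succAbove i)) := by
    intro η
    rw [lineX_apply, mul_smul, ← hq]
    rfl
  apply le_antisymm
  · rintro _ ⟨v, hv, rfl⟩
    have hv1 := mem_lineD.1 hv
    rw [p.line_eq] at hv1
    obtain ⟨c, hc⟩ := Submodule.mem_span_singleton.1 hv1
    have hT := tangentCoordChange_fst h v
    refine ⟨(index W).insertNth (α := fun _ => 𝕜) (c * ξ (index W))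
      (tangentCoordChange 𝓘(𝕜, M.E × (Fin m → 𝕜)) p W p v).2, ?_⟩
    refine (hX _).trans (Prod.ext ?_ ?_)
    · refine Eq.trans ?_ hT.symm
      rw [← hc, map_smul]
      simp [ha]
    · ext i
      simp
  · rintro _ ⟨η, rfl⟩
    set t := lineX W (chartAt (M.E × (Fin m → 𝕜)) W p) η with ht
    have hinv : tangentCoordChange 𝓘(𝕜, M.E × (Fin m → 𝕜)) p W p
        (tangentCoordChange 𝓘(𝕜, M.E × (Fin m → 𝕜)) W p p t) = t := by
      rw [tangentCoordChange_comp, tangentCoordChange_self] <;> simp [h]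
    refine ⟨tangentCoordChange 𝓘(𝕜, M.E × (Fin m → 𝕜)) W p p t, ?_, hinv⟩
    refine mem_lineD.2 ?_
    have h1 := tangentCoordChange_fst h
      (tangentCoordChange 𝓘(𝕜, M.E × (Fin m → 𝕜)) W p p t)
    rw [hinv] at h1
    have h0 := congrArg Prod.fst (hX η)
    rw [← ht, h1] at h0
    replace h1 := h0.symm
    have h2 := congrArg (M.ofChart W.base p.base) h1
    rw [ofChart_toChart hb, map_smul, ofChart_toChart hb] at h2
    rw [← h2, p.line_eq]
    exact Submodule.smul_mem _ _ (Submodule.mem_span_singleton_self _)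

/-- The prolongation `(ℙ D, D¹)` of `(Z, D)`. -/
def prolong (M : DistManifold 𝕜 m) : DistManifold 𝕜 m where
  Pt := LinePt M
  E := M.E × (Fin m → 𝕜)
  D := lineD
  X := lineX
  θ := lineθ
  X_analytic W := by
    refine contDiffOn_clm_apply.2 fun ξ => ?_
    have h1 : ContDiffOn 𝕜 ω (fun q : M.E × (Fin m → 𝕜) =>
        M.X W.base q.1 (ins (index W) q.2)) (chartAt (M.E × (Fin m → 𝕜)) W).target :=
      ((M.X_analytic W.base).comp contDiffOn_fst fun q hq => hq).clm_apply
        ((contDiff_ins _).comp_contDiffOn contDiffOn_snd)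
    exact (contDiffOn_const.smul h1).prodMk contDiffOn_const
  θ_analytic W := by
    refine contDiffOn_clm_apply.2 fun v => contDiffOn_pi.2 fun j => ?_
    rcases Fin.eq_self_or_eq_succAbove (index W) j with rfl | ⟨i, rfl⟩
    · simp only [lineθ_self]
      have h1 : ContDiffOn 𝕜 ω (fun q : M.E × (Fin m → 𝕜) =>
          M.θ W.base q.1 v.1) (chartAt (M.E × (Fin m → 𝕜)) W).target :=
        ((M.θ_analytic W.base).comp contDiffOn_fst fun q hq => hq).clm_apply contDiffOn_const
      exact (contDiff_apply 𝕜 𝕜 (index W)).comp_contDiffOn h1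
    · simp only [lineθ_succAbove]
      exact contDiffOn_const
  θ_X W q hq ξ := by
    ext j
    rcases Fin.eq_self_or_eq_succAbove (index W) j with rfl | ⟨i, rfl⟩
    · rw [lineθ_self, lineX_apply, map_smul, M.θ_X W.base _ hq]
      simp
    · rw [lineθ_succAbove, lineX_apply]
  D_eq := lineD_eq

/-- The space `𝕜 ^ (m + 1)` with its tangent bundle as distribution. -/
def affine (𝕜 : Type u) [RCLike 𝕜] (m : ℕ) : DistManifold 𝕜 m where
  Pt := Fin (m + 1) → 𝕜
  E := Fin (m + 1) → 𝕜
  D _ := ⊤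
  X _ _ := ContinuousLinearMap.id 𝕜 _
  θ _ _ := ContinuousLinearMap.id 𝕜 _
  X_analytic _ := contDiffOn_const
  θ_analytic _ := contDiffOn_const
  θ_X _ _ _ _ := rfl
  D_eq w z hz := by
    have h : ∀ v, tangentCoordChange 𝓘(𝕜, Fin (m + 1) → 𝕜) z w z v = v := by
      intro v
      rw [tangentCoordChange_def, extChartAt_model_space_eq_id, extChartAt_model_space_eq_id]
      simp
    rw [Submodule.map_top]
    apply le_antisymm
    · rintro _ ⟨v, rfl⟩
      exact ⟨v, (h v).symm⟩
    · rintro _ ⟨v, rfl⟩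
      exact ⟨v, h v⟩

/-- The velocity at `t` of a curve in a manifold, an element of the tangent space at `c t`. -/
def velocity (c : 𝕜 → M.Pt) (t : 𝕜) : M.E := mfderiv 𝓘(𝕜, 𝕜) 𝓘(𝕜, M.E) c t (1 : 𝕜)

/-- The curve germ `c₁` at `0` in `ℙ D` is the prolongation of the curve germ `c` at `0` in `Z`:
it is `(c t, span (c' t))` for `t ≠ 0`, and its value at `0` is the limit as `t → 0`. -/
def IsProlongation (c : 𝕜 → M.Pt) (c₁ : 𝕜 → M.prolong.Pt) : Prop :=
  (∀ᶠ t in 𝓝[≠] (0 : 𝕜), LinePt.base (c₁ t) = c t ∧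
    LinePt.line (c₁ t) = Submodule.span 𝕜 {velocity c t}) ∧
  ContinuousAt c₁ 0

/-- The tangent space at `z` of a submanifold `S`: the velocities of the analytic curves
in `S` through `z`. -/
def tangentTo (S : Set M.Pt) (z : M.Pt) : Submodule 𝕜 M.E :=
  Submodule.span 𝕜 {v | ∃ c : 𝕜 → M.Pt, ContMDiffAt 𝓘(𝕜, 𝕜) 𝓘(𝕜, M.E) ω c 0 ∧ c 0 = z ∧
    (∀ᶠ t in 𝓝 (0 : 𝕜), c t ∈ S) ∧ velocity c 0 = v}

/-- The prolongation of a submanifold `S` of `Z`, inside `ℙ D`: the points `(z, ℓ)` where `z ∈ S`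
and the line `ℓ ⊆ D z` is tangent to `S`. -/
def prolongSet (S : Set M.Pt) : Set M.prolong.Pt :=
  {q : LinePt M | q.base ∈ S ∧ q.line ≤ tangentTo S q.base}

end DistManifold

open DistManifold

/-- The Monster tower over `𝕜 ^ (m + 1)`: level `k` is `𝒫^k (m + 1)` with its distribution `Δ_k`. -/
def monster (𝕜 : Type u) [RCLike 𝕜] (m : ℕ) : ℕ → DistManifold 𝕜 m
  | 0 => affine 𝕜 m
  | k + 1 => (monster 𝕜 m k).prolong

namespace monster

variable {𝕜 : Type u} [RCLike 𝕜] {m k : ℕ}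

/-- The point `p` of `ζ = (p, ℓ)`. -/
def below (ζ : (monster 𝕜 m (k + 1)).Pt) : (monster 𝕜 m k).Pt :=
  LinePt.base (M := monster 𝕜 m k) ζ

/-- The line `ℓ` of `ζ = (p, ℓ)`. -/
def line (ζ : (monster 𝕜 m (k + 1)).Pt) : Submodule 𝕜 (monster 𝕜 m k).E :=
  LinePt.line (M := monster 𝕜 m k) ζ

/-- The submanifolds `𝒫^j (F)` of the levels of the tower, for all `j ≥ 0` and all fibres `F` of
the projections `𝒫^(i+1) → 𝒫^i`: the levels of the baby Monsters. -/
inductive IsBabyMonster : ∀ k : ℕ, Set (monster 𝕜 m k).Pt → Prop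
  | fiber {i : ℕ} (p : (monster 𝕜 m i).Pt) :
      IsBabyMonster (i + 1) {q : (monster 𝕜 m (i + 1)).Pt | below q = p}
  | prolong {i : ℕ} {S : Set (monster 𝕜 m i).Pt} :
      IsBabyMonster i S → IsBabyMonster (i + 1) (prolongSet S)

/-- The critical hyperplanes through `p`: the subspaces `Δ_k (p) ∩ T_p (𝒫^j (F))`, for the baby
Monsters `𝒫^j (F)` at level `k` that pass through `p`. -/
def IsCriticalHyperplane (p : (monster 𝕜 m k).Pt) (H : Submodule 𝕜 (monster 𝕜 m k).E) : Prop :=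
  ∃ S : Set (monster 𝕜 m k).Pt, IsBabyMonster k S ∧ p ∈ S ∧
    H = (monster 𝕜 m k).D p ⊓ tangentTo S p

/-- The `k`-fold prolongation of the curve germ `γ` at `0` takes the value `ζ` at `0`. -/
def ReachedBy (ζ : (monster 𝕜 m k).Pt) (γ : 𝕜 → (Fin (m + 1) → 𝕜)) : Prop :=
  ∃ c : ∀ i : ℕ, 𝕜 → (monster 𝕜 m i).Pt, c 0 = γ ∧
    (∀ i < k, IsProlongation (M := monster 𝕜 m i) (c i) (c (i + 1))) ∧ c k 0 = ζ

end monster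

/-- `S` is a `d`-dimensional analytic submanifold of `𝕜 ^ n` (for `d ≤ n`): locally, an analytic
change of coordinates takes it to the coordinate subspace of the first `d` coordinates. -/
def IsAnalyticSubmanifold {𝕜 : Type u} [RCLike 𝕜] {n : ℕ} (d : ℕ) (S : Set (Fin n → 𝕜)) : Prop :=
  ∀ x ∈ S, ∃ φ : OpenPartialHomeomorph (Fin n → 𝕜) (Fin n → 𝕜), x ∈ φ.source ∧
    ContDiffOn 𝕜 ω φ φ.source ∧ ContDiffOn 𝕜 ω φ.symm φ.target ∧
    ∀ y ∈ φ.source, y ∈ S ↔ ∀ i : Fin n, d ≤ i → φ y i = 0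

/-- The embedding dimension of a curve germ at `0`: the least dimension of an analytic
submanifold that contains it. -/
def embeddingDim {𝕜 : Type u} [RCLike 𝕜] {n : ℕ} (γ : 𝕜 → (Fin n → 𝕜)) : ℕ :=
  sInf {d | ∃ S : Set (Fin n → 𝕜), IsAnalyticSubmanifold d S ∧ ∀ᶠ t in 𝓝 (0 : 𝕜), γ t ∈ S}

end

noncomputable section

universe u

open DistManifold

/-! ### Velocities, tangent spaces and frames. -/

namespace DistManifold

variable {𝕜 : Type u} [RCLike 𝕜] {m : ℕ} {M : DistManifold 𝕜 m}

/-! The proof is a dimension count for covectors on the distribution. Let `γ` lie in an analytic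
submanifold `N` of dimension `e`, its embedding dimension.

Suppose an analytic form `β` on `Δ` vanishes along `S` on the vectors of `Δ` tangent to `S`. Then
`β(ℓ) = 0` for every point `(z, ℓ)` of the prolongation `S¹`. In an affine chart this is an analytic
equation on `S¹`, and its differential restricted to `Δ¹` is a form of the same kind for `S¹`
(`Annihilates.prolong`). Its components along the fibre are those of `β` off the chart index. A
fibre contributes one more form, the dual frame covector that vanishes on vertical vectors
(`annihilates_fiber`).

Independent covectors that kill `ℓ` stay independent when read on the vertical directions, so adding
the fibre covector keeps independence (`linearIndependent_insertNth`). By induction on the level,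
one form for each baby Monster through `p`, together with `m + 1 - e` forms coming from the
equations of `N`, are independent at `p` (`Coframe.nonempty_succ`, `nonempty_coframe`).

At `ζ = (p, ℓ)` the forms of `d - 1` baby Monsters and those of `N` all kill `ℓ`. Hence `(d - 1) +
(m + 1 - e) ≤ m`, that is `d ≤ e`.

The prolonged curve is only known to stay in the prolongations of `N` for `t ≠ 0`. Closure is
enough, because `β(ℓ) = 0` is a closed condition (`Annihilates.dotProduct_of_mem_closure`). -/

theorem hasDerivAt_chart_comp {c : 𝕜 → M.Pt} {t : 𝕜} {w : M.Pt}
    (hc : MDifferentiableAt 𝓘(𝕜, 𝕜) 𝓘(𝕜, M.E) c t) (hw : c t ∈ (chartAt M.E w).source) :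
    HasDerivAt (fun s => chartAt M.E w (c s)) (M.toChart w (c t) (velocity c t)) t := by
  have h1 := hc.hasMFDerivAt.2
  have h2 := hasFDerivWithinAt_tangentCoordChange (I := 𝓘(𝕜, M.E))
    (x := c t) (y := w) (z := c t) (by simpa using hw)
  simp only [modelWithCornersSelf_coe, Set.range_id, hasFDerivWithinAt_univ] at h1 h2
  replace h1 : HasFDerivAt (extChartAt 𝓘(𝕜, M.E) (c t) ∘ c)
      (mfderiv 𝓘(𝕜, 𝕜) 𝓘(𝕜, M.E) c t) t := hasFDerivWithinAt_univ.1 h1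
  have h3 := (HasFDerivAt.comp (f := (extChartAt 𝓘(𝕜, M.E) (c t)) ∘ c) t h2 h1).hasDerivAt
  refine HasDerivAt.congr_of_eventuallyEq h3 ?_
  filter_upwards [hc.continuousAt (chart_source_mem_nhds M.E (c t))] with s hs
  have hs' : c s ∈ (chartAt M.E (c t)).source := hs
  simp [(chartAt M.E (c t)).left_inv hs']

/-- Tangent spaces are spanned by velocities of curves in `S`, and along such a curve the function
is constant near time `0`. -/
theorem fderiv_toChart_eq_zero {G : Type*} [NormedAddCommGroup G] [NormedSpace 𝕜 G]
    {S : Set M.Pt} {w z : M.Pt} {F : M.E → G} (hw : z ∈ (chartAt M.E w).source)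
    (hF : DifferentiableAt 𝕜 F (chartAt M.E w z))
    (hS : ∃ g, ∀ᶠ z' in 𝓝 z, z' ∈ S → F (chartAt M.E w z') = g)
    {v : M.E} (hv : v ∈ tangentTo S z) :
    fderiv 𝕜 F (chartAt M.E w z) (M.toChart w z v) = 0 := by
  obtain ⟨g, hg⟩ := hS
  suffices tangentTo S z ≤ LinearMap.ker
      ((fderiv 𝕜 F (chartAt M.E w z)).comp (M.toChart w z) : M.E →ₗ[𝕜] G) from this hv
  refine Submodule.span_le.2 ?_
  rintro _ ⟨c, hc, rfl, hcS, rfl⟩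
  have h1 := hasDerivAt_chart_comp (hc.mdifferentiableAt (by simp)) hw
  have h2 := hF.hasFDerivAt.comp_hasDerivAt 0 h1
  refine h2.unique ((hasDerivAt_const 0 g).congr_of_eventuallyEq ?_)
  filter_upwards [hcS, hc.continuousAt.eventually hg] with t h3 h4 using h4 h3

theorem X_frameCoord {w z : M.Pt} (h : z ∈ (chartAt M.E w).source) {v : M.E} (hv : v ∈ M.D z) :
    M.X w (chartAt M.E w z) (frameCoord w z v) = M.toChart w z v := by
  conv_rhs => rw [← frameVec_frameCoord h hv]
  unfold frameVec
  rw [toChart_ofChart h]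

/-! ### Annihilating one-forms and their prolongation. -/

/-- The analytic one-form on the distribution with components `B`, in the frame over the chart at
`p`, vanishes near `p` on the vectors of the distribution that are tangent to `S`. -/
def Annihilates (S : Set M.Pt) (p : M.Pt) (B : M.E → (Fin (m + 1) → 𝕜)) : Prop :=
  ContDiffAt 𝕜 ω B (chartAt M.E p p) ∧
    ∀ᶠ z in 𝓝 p, z ∈ S → ∀ v ∈ M.D z ⊓ tangentTo S z,
      B (chartAt M.E p z) ⬝ᵥ frameCoord p z v = 0

theorem continuous_base : Continuous (LinePt.base : LinePt M → M.Pt) :=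
  continuous_iff_continuousAt.2 fun p => (hasMFDerivAt_base p).continuousAt

theorem chartAt_apply (q z : LinePt M) : chartAt (M.E × (Fin m → 𝕜)) q z =
    (chartAt M.E q.base z.base, slope (index q) (frameCoord q.base z.base z.gen)) := rfl

theorem Annihilates.eventually_dotProduct {S : Set M.Pt} {q : LinePt M}
    {B : M.E → (Fin (m + 1) → 𝕜)} (hB : Annihilates S q.base B) :
    ∀ᶠ z : LinePt M in 𝓝 q, z ∈ prolongSet S →
      B (chartAt (M.E × (Fin m → 𝕜)) q z).1 ⬝ᵥ
        ins (index q) (chartAt (M.E × (Fin m → 𝕜)) q z).2 = 0 := by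
  filter_upwards [continuous_base.continuousAt.eventually hB.2,
    chart_source_mem_nhds (M.E × (Fin m → 𝕜)) q] with z hz hs hzS
  have h1 := hz hzS.1 z.gen ⟨z.gen_mem, hzS.2 (by
    rw [z.line_eq]; exact Submodule.mem_span_singleton_self _)⟩
  rw [chartAt_apply, ins_slope _ hs.2, dotProduct_smul, h1, smul_zero]

/-- The components of the one-form on the prolonged distribution obtained by differentiating the
equation `B (ℓ) = 0`. -/
def prolongForm (q : LinePt M) (B : M.E → (Fin (m + 1) → 𝕜)) (x : M.E × (Fin m → 𝕜)) :
    Fin (m + 1) → 𝕜 :=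
  (index q).insertNth (α := fun _ => 𝕜)
    (fderiv 𝕜 B x.1 (M.X q.base x.1 (ins (index q) x.2)) ⬝ᵥ ins (index q) x.2)
    fun i => B x.1 ((index q).succAbove i)

/-- Product rule. Entry `a` of `ins a` is the constant `1`, so the component of `B` at `a` is
missing from the last sum; this is the source of the shape of `prolongForm`. -/
theorem fderiv_dotProduct_ins (a : Fin (m + 1)) {E : Type*} [NormedAddCommGroup E]
    [NormedSpace 𝕜 E] {B : E → (Fin (m + 1) → 𝕜)} {x : E × (Fin m → 𝕜)}
    (hB : DifferentiableAt 𝕜 B x.1) :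
    HasFDerivAt (fun x : E × (Fin m → 𝕜) => B x.1 ⬝ᵥ ins a x.2)
      (fderiv 𝕜 (fun x : E × (Fin m → 𝕜) => B x.1 ⬝ᵥ ins a x.2) x) x ∧
    ∀ v, fderiv 𝕜 (fun x : E × (Fin m → 𝕜) => B x.1 ⬝ᵥ ins a x.2) x v =
      fderiv 𝕜 B x.1 v.1 ⬝ᵥ ins a x.2 + ∑ i, B x.1 (a.succAbove i) * v.2 i := by
  have hb : ∀ j, HasFDerivAt (fun y : E × (Fin m → 𝕜) => B y.1 j)
      (((ContinuousLinearMap.proj (R := 𝕜) (φ := fun _ : Fin (m + 1) => 𝕜) j).comp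
        (fderiv 𝕜 B x.1)).comp (ContinuousLinearMap.fst 𝕜 E (Fin m → 𝕜))) x := fun j =>
    HasFDerivAt.comp x (f := Prod.fst) (g := fun y => B y j)
      (hasFDerivAt_pi'.1 hB.hasFDerivAt j) hasFDerivAt_fst
  have hu : ∀ i, HasFDerivAt (fun y : E × (Fin m → 𝕜) => y.2 i)
      ((ContinuousLinearMap.proj (R := 𝕜) (φ := fun _ : Fin m => 𝕜) i).comp
        (ContinuousLinearMap.snd 𝕜 E (Fin m → 𝕜))) x := fun i =>
    hasFDerivAt_pi'.1 hasFDerivAt_snd i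
  have h := (hb a).add (HasFDerivAt.fun_sum (u := Finset.univ) fun i _ =>
    (hb (a.succAbove i)).mul (hu i))
  have h' := h.congr_of_eventuallyEq (f₁ := fun x : E × (Fin m → 𝕜) => B x.1 ⬝ᵥ ins a x.2)
    (Filter.Eventually.of_forall fun y => by simp [dotProduct, Fin.sum_univ_succAbove _ a])
  refine ⟨h'.differentiableAt.hasFDerivAt, fun v => ?_⟩
  rw [h'.fderiv]
  simp [dotProduct, Fin.sum_univ_succAbove _ a, Finset.sum_add_distrib]
  simp only [mul_comm]
  ring

theorem contDiffAt_prolongForm {q : LinePt M} {B : M.E → (Fin (m + 1) → 𝕜)}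
    (hB : ContDiffAt 𝕜 ω B (chartAt M.E q.base q.base)) :
    ContDiffAt 𝕜 ω (prolongForm q B) (chartAt (M.E × (Fin m → 𝕜)) q q) := by
  have h1 : ContDiffAt 𝕜 ω (Prod.fst : M.E × (Fin m → 𝕜) → M.E)
    (chartAt (M.E × (Fin m → 𝕜)) q q) := contDiffAt_fst
  have hi : ContDiffAt 𝕜 ω (fun x : M.E × (Fin m → 𝕜) => ins (index q) x.2)
      (chartAt (M.E × (Fin m → 𝕜)) q q) := (contDiff_ins _).contDiffAt.comp _ contDiffAt_snd
  have hX : ContDiffAt 𝕜 ω (M.X q.base) (chartAt (M.E × (Fin m → 𝕜)) q q).1 :=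
    (M.X_analytic q.base).contDiffAt ((chartAt M.E q.base).open_target.mem_nhds
      ((chartAt M.E q.base).map_source (mem_chart_source M.E q.base)))
  have hB' : ContDiffAt 𝕜 ω B (chartAt (M.E × (Fin m → 𝕜)) q q).1 := hB
  have hd := (hB'.fderiv_right (m := ω) (by simp)).comp _ h1
  have hv := hd.clm_apply ((hX.comp _ h1).clm_apply hi)
  refine contDiffAt_pi.2 fun j => ?_
  rcases Fin.eq_self_or_eq_succAbove (index q) j with rfl | ⟨i, rfl⟩
  · simp only [prolongForm, Fin.insertNth_apply_same, dotProduct]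
    exact ContDiffAt.sum fun j _ => (contDiffAt_pi.1 hv j).mul (contDiffAt_pi.1 hi j)
  · simp only [prolongForm, Fin.insertNth_apply_succAbove]
    exact (contDiffAt_pi.1 hB' _).comp _ h1

/-- The function `B · ins` vanishes on the prolonged set, so its differential kills tangent vectors
there. On a vector of the prolonged distribution, written in the frame `lineX`, this differential is
`prolongForm`. -/
theorem Annihilates.prolong {S : Set M.Pt} {q : LinePt M} {B : M.E → (Fin (m + 1) → 𝕜)}
    (hB : Annihilates S q.base B) :
    Annihilates (M := M.prolong) (prolongSet S) q (prolongForm q B) := by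
  refine ⟨contDiffAt_prolongForm hB.1, ?_⟩
  have hd : ∀ᶠ z : LinePt M in 𝓝 q,
      DifferentiableAt 𝕜 B (chartAt (M.E × (Fin m → 𝕜)) q z).1 := by
    have h1 : ContinuousAt (fun z : LinePt M => (chartAt (M.E × (Fin m → 𝕜)) q z).1) q :=
      continuous_fst.continuousAt.comp
        ((chartAt (M.E × (Fin m → 𝕜)) q).continuousAt (mem_chart_source _ q))
    refine h1.eventually (p := fun y => DifferentiableAt 𝕜 B y) ?_
    have h2 := hB.1.eventually (by simp)
    filter_upwards [h2] with y hy using hy.differentiableAt (by simp)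
  -- The equation is needed on a neighbourhood of each nearby `z`, so that it can be differentiated
  -- at `z`.
  filter_upwards [hd, eventually_eventually_nhds.2 hB.eventually_dotProduct,
    chart_source_mem_nhds (M.E × (Fin m → 𝕜)) q] with z h1 h2 h3 hzS v hv
  obtain ⟨h4, h5⟩ := fderiv_dotProduct_ins (index q) h1
  have h6 := fderiv_toChart_eq_zero (M := M.prolong) (S := prolongSet S) (w := q) (z := z)
    h3 h4.differentiableAt ⟨0, h2⟩ hv.2
  have h7 : lineX q (chartAt (M.E × (Fin m → 𝕜)) q z) (frameCoord (M := M.prolong) q z v) =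
    M.prolong.toChart q z v := X_frameCoord (M := M.prolong) h3 hv.1
  rw [← h7] at h6
  have h8 := (h5 _).symm.trans h6
  rw [← h8]
  generalize frameCoord (M := M.prolong) q z v = η
  have h9 : chartAt (H := M.prolong.E) (M := M.prolong.Pt) q z =
    chartAt (M.E × (Fin m → 𝕜)) q z := rfl
  rw [h9, lineX_apply, dotProduct, Fin.sum_univ_succAbove _ (index q)]
  simp [prolongForm, mul_comm]

/-- The base point is constant on the fibre, so tangent vectors to it have zero base component, and
the frame coordinate at `index q` is read from that component alone. -/
theorem annihilates_fiber (q : LinePt M) :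
    Annihilates (M := M.prolong) {z : LinePt M | z.base = q.base} q
      (fun _ => Pi.single (index q) 1) := by
  refine ⟨contDiffAt_const, ?_⟩
  filter_upwards [chart_source_mem_nhds (M.E × (Fin m → 𝕜)) q] with z h3 hz v hv
  have h6 := fderiv_toChart_eq_zero (M := M.prolong) (w := q) (z := z)
    (F := (Prod.fst : M.E × (Fin m → 𝕜) → M.E)) h3 differentiableAt_fst
    ⟨chartAt M.E q.base q.base, Filter.Eventually.of_forall fun z' (hz' : z'.base = _) => 
      congrArg (chartAt M.E q.base) hz'⟩ hv.2
  have h7 : (M.prolong.toChart q z v).1 = 0 := by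
    rw [← h6]
    erw [fderiv_fst]
    rfl
  rw [single_one_dotProduct]
  have h8 := lineθ_self q (chartAt (M.E × (Fin m → 𝕜)) q z) (M.prolong.toChart q z v)
  rw [h7, map_zero] at h8
  exact h8

end DistManifold

/-! ### Linear algebra of one prolongation step. -/

/-- A covector that kills `ξ` and vanishes off `a` is zero, because `ξ a = 1`. So deleting entry `a`
loses no independence among the `f i`, whatever values `h` are put there, and `Pi.single a 1` lies
outside their span. -/
theorem linearIndependent_insertNth {K ι : Type*} [Field K] {m : ℕ} {f : ι → Fin (m + 1) → K}
    (hf : LinearIndependent K f) (a : Fin (m + 1)) {ξ : Fin (m + 1) → K} (hξ : ξ a = 1)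
    (hfξ : ∀ i, f i ⬝ᵥ ξ = 0) (h : ι → K) :
    LinearIndependent K (fun o : Option ι => o.elim (Pi.single a 1)
      fun i => a.insertNth (α := fun _ => K) (h i) fun j => f i (a.succAbove j)) := by
  have hker : ∀ l : Fin (m + 1) → K, (∀ j, l (a.succAbove j) = 0) → l ⬝ᵥ ξ = 0 → l = 0 := by
    intro l h1 h2
    rw [dotProduct, Fin.sum_univ_succAbove _ a] at h2
    ext j
    rcases Fin.eq_self_or_eq_succAbove a j with rfl | ⟨i, rfl⟩
    · simpa [h1, hξ] using h2
    · exact h1 i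
  rw [linearIndependent_option]
  constructor
  · rw [linearIndependent_iff] at hf ⊢
    intro l hl
    apply hf
    rw [Finsupp.linearCombination_apply] at hl ⊢
    apply hker
    · intro j
      have := congrFun hl (a.succAbove j)
      simpa [Finsupp.sum] using this
    · simp [Finsupp.sum, sum_dotProduct, hfξ]
  · intro hmem
    obtain ⟨l, hl⟩ := (Finsupp.mem_span_range_iff_exists_finsupp).1 hmem
    have h0 : l = 0 := by
      rw [linearIndependent_iff] at hf
      apply hf
      rw [Finsupp.linearCombination_apply]
      apply hker
      · intro j
        have := congrFun hl (a.succAbove j)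
        simpa [Finsupp.sum] using this
      · simp [Finsupp.sum, sum_dotProduct, hfξ]
    have := congrFun hl a
    simp [h0] at this

/-! ### Prolonged curves, limit points, and forms from a submanifold of affine space. -/

namespace DistManifold

variable {𝕜 : Type u} [RCLike 𝕜] {m : ℕ} {M : DistManifold 𝕜 m}

/-- `tangentTo` uses curves based at time `0`, so the curve is reparametrised by a translation. -/
theorem velocity_mem_tangentTo {S : Set M.Pt} {c : 𝕜 → M.Pt} {t : 𝕜}
    (hc : ContMDiffAt 𝓘(𝕜, 𝕜) 𝓘(𝕜, M.E) ω c t) (hS : ∀ᶠ s in 𝓝 t, c s ∈ S) :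
    velocity c t ∈ tangentTo S (c t) := by
  have ht : Filter.Tendsto (fun s : 𝕜 => t + s) (𝓝 0) (𝓝 t) := by
    have := (continuous_const_add t).tendsto 0
    rwa [add_zero] at this
  have hc' : ContMDiffAt 𝓘(𝕜, 𝕜) 𝓘(𝕜, M.E) ω c (t + 0) := by rwa [add_zero]
  have hadd : HasMFDerivAt 𝓘(𝕜, 𝕜) 𝓘(𝕜, 𝕜) (fun s : 𝕜 => t + s) 0
      (ContinuousLinearMap.id 𝕜 𝕜) := ((hasFDerivAt_id (0 : 𝕜)).const_add t).hasMFDerivAt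
  refine Submodule.subset_span ⟨fun s => c (t + s), ?_, by simp, ht.eventually hS, ?_⟩
  · refine ContMDiffAt.comp (g := c) 0 hc' ?_
    exact (contDiffAt_const.add contDiffAt_id).contMDiffAt
  · have h := (hc'.mdifferentiableAt (by simp)).hasMFDerivAt.comp 0 hadd
    unfold velocity
    erw [h.mfderiv]
    change mfderiv 𝓘(𝕜, 𝕜) 𝓘(𝕜, M.E) c (t + 0) (1 : 𝕜) = _
    rw [add_zero]

/-- In the affine chart at `c₁ t` the fibre coordinates are the slopes of the frame coordinates of
the derivative of `c`, and these are analytic. The relation is assumed at `t` itself, which makes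
the denominator nonzero there. -/
theorem contMDiffAt_prolongation {c : 𝕜 → M.Pt} {c₁ : 𝕜 → LinePt M} {t : 𝕜}
    (hc : ContMDiffAt 𝓘(𝕜, 𝕜) 𝓘(𝕜, M.E) ω c t)
    (h : ∀ᶠ s in 𝓝 t, (c₁ s).base = c s ∧ (c₁ s).line = Submodule.span 𝕜 {velocity c s}) :
    ContMDiffAt 𝓘(𝕜, 𝕜) 𝓘(𝕜, M.E × (Fin m → 𝕜)) ω c₁ t := by
  set q := c₁ t with hq
  have hqb : q.base = c t := h.self_of_nhds.1
  have hsrc : c t ∈ (chartAt M.E q.base).source := hqb ▸ mem_chart_source M.E q.base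
  set y : 𝕜 → M.E := fun s => chartAt M.E q.base (c s) with hy
  have hyan : ContDiffAt 𝕜 ω y t := by
    have := (contMDiffAt_of_mem_maximalAtlas (I := 𝓘(𝕜, M.E)) (n := ω)
      (IsManifold.chart_mem_maximalAtlas (I := 𝓘(𝕜, M.E)) (n := ω) q.base) hsrc).comp t hc
    exact this.contDiffAt
  set ξ : 𝕜 → (Fin (m + 1) → 𝕜) := fun s => M.θ q.base (y s) (deriv y s) with hξ
  have hθ : ContDiffAt 𝕜 ω (M.θ q.base) (y t) :=
    (M.θ_analytic q.base).contDiffAt ((chartAt M.E q.base).open_target.mem_nhds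
      ((chartAt M.E q.base).map_source hsrc))
  have hξan : ContDiffAt 𝕜 ω ξ t := (hθ.comp t hyan).clm_apply
    ((hyan.fderiv_right (m := ω) (by simp)).clm_apply contDiffAt_const)
  -- The chosen generator and the velocity span the same line; the factor `r` depends on `s` with no
  -- regularity, but `slope` does not see it.
  have hgen : ∀ᶠ s in 𝓝 t, (c₁ s).base = c s ∧ c s ∈ (chartAt M.E q.base).source ∧
      ∃ r : 𝕜, r ≠ 0 ∧ frameCoord q.base (c₁ s).base (c₁ s).gen = r • ξ s := by
    filter_upwards [h, (contMDiffAt_iff_contMDiffAt_nhds (by simp)).1 hc,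
      hc.continuousAt.eventually ((chartAt M.E q.base).open_source.mem_nhds hsrc)]
      with s h1 h2 h3
    refine ⟨h1.1, h3, ?_⟩
    have h4 : (c₁ s).gen ∈ (c₁ s).line := by
      rw [(c₁ s).line_eq]; exact Submodule.mem_span_singleton_self _
    rw [h1.2] at h4
    obtain ⟨r, hr⟩ := Submodule.mem_span_singleton.1 h4
    refine ⟨r, ?_, ?_⟩
    · rintro rfl
      exact (c₁ s).gen_ne (by rw [← hr]; exact zero_smul 𝕜 _)
    · rw [← hr, frameCoord_smul, h1.1]
      have h5 := hasDerivAt_chart_comp (h2.mdifferentiableAt (by simp)) h3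
      rw [hξ, hy]
      simp only
      rw [h5.deriv]
      rfl
  have hne : ξ t (index q) ≠ 0 := by
    obtain ⟨_, _, r, _, h2⟩ := hgen.self_of_nhds
    intro h0
    exact (mem_lineChart_source q).2 (by
      change frameCoord q.base (c₁ t).base (c₁ t).gen (index q) = 0
      rw [h2, Pi.smul_apply, h0, smul_zero])
  have hslope : ContDiffAt 𝕜 ω (slope (index q)) (ξ t) := (contDiffOn_slope (index q)).contDiffAt
    ((isOpen_ne.preimage (continuous_apply (index q))).mem_nhds hne)
  have hxan : ContDiffAt 𝕜 ω (fun s => (y s, slope (index q) (ξ s))) t :=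
    hyan.prodMk (hslope.comp t hξan)
  have heq : c₁ =ᶠ[𝓝 t] fun s =>
      (chartAt (M.E × (Fin m → 𝕜)) q).symm (y s, slope (index q) (ξ s)) := by
    filter_upwards [hgen, (contDiffAt_pi.1 hξan (index q)).continuousAt.eventually_ne hne]
      with s ⟨h1, h2, r, hr, h3⟩ h4
    have hs : c₁ s ∈ (chartAt (M.E × (Fin m → 𝕜)) q).source := by
      refine ⟨by rw [h1]; exact h2, ?_⟩
      rw [h3]
      exact mul_ne_zero hr h4
    rw [← (chartAt (M.E × (Fin m → 𝕜)) q).left_inv hs, chartAt_apply, h3, slope_smul _ hr, h1]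
  refine ContMDiffAt.congr_of_eventuallyEq ?_ heq
  have hx : (y t, slope (index q) (ξ t)) ∈ (chartAt (M.E × (Fin m → 𝕜)) q).target :=
    (chartAt M.E q.base).map_source hsrc
  exact ((contMDiffOn_chart_symm (I := 𝓘(𝕜, M.E × (Fin m → 𝕜))) (n := ω)).contMDiffAt
    ((chartAt (M.E × (Fin m → 𝕜)) q).open_target.mem_nhds hx)).comp t hxan.contMDiffAt

/-- The equation `B(ℓ) = 0` holds on the prolonged set near `q` and is continuous, so it passes to
limit points. -/
theorem Annihilates.dotProduct_of_mem_closure {S : Set M.Pt} {q : LinePt M}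
    {B : M.E → (Fin (m + 1) → 𝕜)} (hB : Annihilates S q.base B)
    (hq : q ∈ closure (prolongSet S : Set (LinePt M))) :
    B (chartAt M.E q.base q.base) ⬝ᵥ
      ins (index q) (chartAt (M.E × (Fin m → 𝕜)) q q).2 = 0 := by
  have h1 := (chartAt (M.E × (Fin m → 𝕜)) q).continuousAt (mem_chart_source _ q)
  have h2 : ContinuousAt (fun z : LinePt M => B (chartAt (M.E × (Fin m → 𝕜)) q z).1) q :=
    ContinuousAt.comp (g := B) hB.1.continuousAt (continuous_fst.continuousAt.comp h1)
  have h3 : ContinuousAt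
      (fun z : LinePt M => ins (index q) (chartAt (M.E × (Fin m → 𝕜)) q z).2) q :=
    (contDiff_ins (𝕜 := 𝕜) (index q)).continuous.continuousAt.comp
      (continuous_snd.continuousAt.comp h1)
  have h4 : ContinuousAt (fun z : LinePt M => B (chartAt (M.E × (Fin m → 𝕜)) q z).1 ⬝ᵥ
      ins (index q) (chartAt (M.E × (Fin m → 𝕜)) q z).2) q :=
    tendsto_finsetSum _ fun j _ => ((continuousAt_pi.1 h2 j).mul (continuousAt_pi.1 h3 j))
  have h5 := (mem_closure_iff_frequently.1 hq).and_eventually hB.eventually_dotProduct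
  exact isClosed_singleton.mem_of_frequently_of_tendsto (s := {(0 : 𝕜)})
    (h5.mono fun z hz => hz.2 hz.1) h4

theorem frameCoord_affine (w z : (affine 𝕜 m).Pt) (v : (affine 𝕜 m).E) :
    frameCoord (M := affine 𝕜 m) w z v = v ∧ (affine 𝕜 m).toChart w z v = v := by
  have h : ∀ w z v : Fin (m + 1) → 𝕜,
      tangentCoordChange 𝓘(𝕜, Fin (m + 1) → 𝕜) z w z v = v := by
    intro w z v
    rw [tangentCoordChange_def, extChartAt_model_space_eq_id, extChartAt_model_space_eq_id]
    simp
  exact ⟨h w z v, h w z v⟩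

theorem dotProduct_fderiv_single {n : ℕ} (L : (Fin n → 𝕜) →L[𝕜] (Fin n → 𝕜)) (i : Fin n)
    (v : Fin n → 𝕜) : (fun j => L (Pi.single j 1) i) ⬝ᵥ v = L v i := by
  conv_rhs => rw [pi_eq_sum_univ' v]
  simp [dotProduct, mul_comm]

/-- The coordinates `φ i` with `e ≤ i` vanish on `N`, so their differentials kill its tangent
vectors. -/
theorem annihilates_submanifold {e : ℕ} {N : Set (Fin (m + 1) → 𝕜)}
    {φ : OpenPartialHomeomorph (Fin (m + 1) → 𝕜) (Fin (m + 1) → 𝕜)}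
    (hφ : ContDiffOn 𝕜 ω φ φ.source)
    (hN : ∀ y ∈ φ.source, y ∈ N ↔ ∀ i : Fin (m + 1), e ≤ i → φ y i = 0)
    {x : Fin (m + 1) → 𝕜} (hx : x ∈ φ.source) {i : Fin (m + 1)} (hi : e ≤ i) :
    Annihilates (M := affine 𝕜 m) N x fun y j => fderiv 𝕜 φ y (Pi.single j 1) i := by
  have hφ' : ∀ y ∈ φ.source, ContDiffAt 𝕜 ω φ y := fun y hy =>
    hφ.contDiffAt (φ.open_source.mem_nhds hy)
  refine ⟨contDiffAt_pi.2 fun j => ?_, ?_⟩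
  · exact contDiffAt_pi.1 (((hφ' x hx).fderiv_right (m := ω) (by simp)).clm_apply
      contDiffAt_const) i
  · have hs : φ.source ∈ 𝓝 x := φ.open_source.mem_nhds hx
    filter_upwards [hs] with z hz _ v hv
    have hd : DifferentiableAt 𝕜 φ z := (hφ' z hz).differentiableAt (by simp)
    have h1 := fderiv_toChart_eq_zero (M := affine 𝕜 m) (S := N) (w := x) (z := z)
      (F := fun y => φ y i) (Set.mem_univ z) (differentiableAt_pi.1 hd i)
      ⟨0, by
        filter_upwards [φ.open_source.mem_nhds hz] with y hy hyN
        exact (hN y hy).1 hyN i hi⟩ hv.2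
    rw [(frameCoord_affine x z v).2] at h1
    rw [(frameCoord_affine x z v).1]
    refine (dotProduct_fderiv_single _ i v).trans (Eq.trans ?_ h1)
    change _ = fderiv 𝕜 (fun y => φ y i) z v
    rw [fderiv_apply hd]
    rfl

theorem linearIndependent_fderiv {n : ℕ}
    {φ : OpenPartialHomeomorph (Fin n → 𝕜) (Fin n → 𝕜)}
    (hφ : ContDiffOn 𝕜 ω φ φ.source) (hφ' : ContDiffOn 𝕜 ω φ.symm φ.target)
    {x : Fin n → 𝕜} (hx : x ∈ φ.source) :
    LinearIndependent 𝕜 fun (i : Fin n) (j : Fin n) => fderiv 𝕜 φ x (Pi.single j 1) i := by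
  have h1 : HasFDerivAt φ (fderiv 𝕜 φ x) (φ.symm (φ x)) := by
    rw [φ.left_inv hx]
    exact ((hφ.contDiffAt (φ.open_source.mem_nhds hx)).differentiableAt (by simp)).hasFDerivAt
  have h2 := ((hφ'.contDiffAt (φ.open_target.mem_nhds (φ.map_source hx))).differentiableAt
    (by simp)).hasFDerivAt
  have h3 := (h1.comp _ h2).unique ((hasFDerivAt_id (φ x)).congr_of_eventuallyEq (by
    filter_upwards [φ.open_target.mem_nhds (φ.map_source hx)] with y hy using φ.right_inv hy))
  rw [Fintype.linearIndependent_iff]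
  intro g hg i
  -- Pairing the relation with column `i` of the inverse Jacobian isolates `g i`.
  have h4 : (∑ i, g i • fun j => fderiv 𝕜 φ x (Pi.single j 1) i) ⬝ᵥ
      fderiv 𝕜 φ.symm (φ x) (Pi.single i 1) = 0 := by rw [hg, zero_dotProduct]
  have h5 := DFunLike.congr_fun h3 (Pi.single i 1)
  simp only [ContinuousLinearMap.comp_apply, ContinuousLinearMap.id_apply] at h5
  simp only [sum_dotProduct, smul_dotProduct, dotProduct_fderiv_single, h5] at h4
  simpa [Pi.single_apply] using h4

end DistManifold

/-! ### Independent forms along the tower, by induction on the level. -/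

namespace monster

variable {𝕜 : Type u} [RCLike 𝕜] {m : ℕ}

/-- The iterated prolongations of a subset of `𝕜 ^ (m + 1)`. -/
def tower (N : Set (Fin (m + 1) → 𝕜)) : ∀ k : ℕ, Set (monster 𝕜 m k).Pt
  | 0 => N
  | k + 1 => prolongSet (tower N k)

/-- The projection of the tower to its lowest level. -/
def root : ∀ k : ℕ, (monster 𝕜 m k).Pt → (Fin (m + 1) → 𝕜)
  | 0 => id
  | k + 1 => fun q => root k (below q)

theorem continuous_below {k : ℕ} :
    Continuous (below : (monster 𝕜 m (k + 1)).Pt → (monster 𝕜 m k).Pt) :=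
  continuous_base (M := monster 𝕜 m k)

theorem continuous_root : ∀ k : ℕ, Continuous (root k : (monster 𝕜 m k).Pt → _)
  | 0 => continuous_id
  | k + 1 => (continuous_root k).comp continuous_below

/-- Away from `t = 0` each prolongation is analytic and its line is spanned by the velocity of a
curve inside the previous prolongation of `N`. Nothing is claimed at `t = 0`, where the velocity may
vanish. -/
theorem eventually_mem_tower {γ : 𝕜 → (Fin (m + 1) → 𝕜)} (hγ : AnalyticAt 𝕜 γ 0)
    {N : Set (Fin (m + 1) → 𝕜)} (hN : ∀ᶠ t in 𝓝 (0 : 𝕜), γ t ∈ N)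
    {c : ∀ i : ℕ, 𝕜 → (monster 𝕜 m i).Pt} (h0 : c 0 = γ) {k : ℕ}
    (hc : ∀ i < k, IsProlongation (M := monster 𝕜 m i) (c i) (c (i + 1))) :
    ∀ i ≤ k, ∀ᶠ t in 𝓝[≠] (0 : 𝕜),
      ContMDiffAt 𝓘(𝕜, 𝕜) 𝓘(𝕜, (monster 𝕜 m i).E) ω (c i) t ∧
        c i t ∈ tower N i ∧ root i (c i t) = γ t := by
  intro i
  induction i with
  | zero =>
    intro _
    have h1 : ∀ᶠ t in 𝓝[≠] (0 : 𝕜), AnalyticAt 𝕜 γ t :=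
      hγ.eventually_analyticAt.filter_mono nhdsWithin_le_nhds
    filter_upwards [h1, hN.filter_mono nhdsWithin_le_nhds] with t h2 h3
    rw [h0]
    exact ⟨h2.contDiffAt.contMDiffAt, h3, rfl⟩
  | succ i ih =>
    intro hi
    filter_upwards [eventually_eventually_nhdsWithin.2 (ih (by omega)),
      eventually_eventually_nhdsWithin.2 (hc i (by omega)).1, self_mem_nhdsWithin]
      with t h1 h2 h3
    -- Since `t ≠ 0`, the hypotheses hold on a full neighbourhood of `t`.
    rw [IsOpen.nhdsWithin_eq isOpen_compl_singleton h3] at h1 h2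
    obtain ⟨h4, h5, h6⟩ := h1.self_of_nhds
    obtain ⟨h7, h8⟩ := h2.self_of_nhds
    refine ⟨contMDiffAt_prolongation h4 h2, ⟨?_, ?_⟩, ?_⟩
    · rw [h7]; exact h5
    · rw [h7, h8, Submodule.span_singleton_le_iff_mem]
      exact velocity_mem_tangentTo h4 (h1.mono fun s hs => hs.2.1)
    · rw [← h6, ← h7]; rfl

theorem eq_fiber_or_eq_prolongSet {k : ℕ} {S : Set (monster 𝕜 m (k + 1)).Pt}
    (hS : IsBabyMonster (k + 1) S) {q : (monster 𝕜 m (k + 1)).Pt} (hq : q ∈ S) :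
    S = {z | below z = below q} ∨ ∃ S', IsBabyMonster k S' ∧ S = prolongSet S' := by
  cases hS with
  | fiber p =>
    left
    have h : below q = p := hq
    rw [h]
  | prolong h => exact Or.inr ⟨_, h, rfl⟩

/-- Independent one-forms at `p`, vanishing on the baby Monsters through `p` and on the
prolongations of `N`. -/
structure Coframe (N : Set (Fin (m + 1) → 𝕜)) (r k : ℕ) (p : (monster 𝕜 m k).Pt) where
  baby : Set (monster 𝕜 m k).Pt → (monster 𝕜 m k).E → (Fin (m + 1) → 𝕜)
  sub : Fin r → (monster 𝕜 m k).E → (Fin (m + 1) → 𝕜)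
  baby_annihilates : ∀ S, IsBabyMonster k S → p ∈ S → Annihilates S p (baby S)
  sub_annihilates : ∀ i, Annihilates (tower N k) p (sub i)
  indep : LinearIndependent 𝕜 (Sum.elim
    (fun S : {S // IsBabyMonster k S ∧ p ∈ S} => baby S (chartAt (monster 𝕜 m k).E p p))
    fun i => sub i (chartAt (monster 𝕜 m k).E p p))

/-- Only the baby Monsters to which the line of `q` is tangent are kept: their forms, and those of
`N`, kill that line. The extra index `none` carries the fibre covector. The free values `h` serve
both the induction and the final count. -/
theorem Coframe.linearIndependent_option {N : Set (Fin (m + 1) → 𝕜)} {r k : ℕ}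
    {q : (monster 𝕜 m (k + 1)).Pt} (F : Coframe N r k (below q))
    (hq : q ∈ closure (tower N (k + 1)))
    (h : {S // IsBabyMonster k S ∧ q ∈ prolongSet S} ⊕ Fin r → 𝕜) :
    LinearIndependent 𝕜 (fun o : Option ({S // IsBabyMonster k S ∧ q ∈ prolongSet S} ⊕ Fin r) =>
      o.elim (Pi.single (index (M := monster 𝕜 m k) q) 1) fun i =>
        (index (M := monster 𝕜 m k) q).insertNth (α := fun _ => 𝕜) (h i) fun j =>
          Sum.elim (fun S => F.baby S.1 (chartAt (monster 𝕜 m k).E (below q) (below q)))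
            (fun i => F.sub i (chartAt (monster 𝕜 m k).E (below q) (below q))) i
            ((index (M := monster 𝕜 m k) q).succAbove j)) := by
  refine linearIndependent_insertNth ?_ (index (M := monster 𝕜 m k) q)
    (ξ := ins (index (M := monster 𝕜 m k) q)
      (chartAt ((monster 𝕜 m k).E × (Fin m → 𝕜)) (M := LinePt (monster 𝕜 m k)) q q).2)
    (ins_self _ _) ?_ h
  · have := F.indep.comp (Sum.map (fun S : {S // IsBabyMonster k S ∧ q ∈ prolongSet S} =>
      (⟨S.1, S.2.1, S.2.2.1⟩ : {S // IsBabyMonster k S ∧ below q ∈ S})) id)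
      (Sum.map_injective.2 ⟨fun S T hST => Subtype.ext (Subtype.mk.inj hST),
        Function.injective_id⟩)
    convert this using 1
    ext i
    rcases i with i | i <;> rfl
  · rintro (⟨S, hS, hqS⟩ | i)
    · exact (F.baby_annihilates S hS hqS.1).dotProduct_of_mem_closure
        (M := monster 𝕜 m k) (q := q) (subset_closure hqS)
    · exact (F.sub_annihilates i).dotProduct_of_mem_closure (M := monster 𝕜 m k) (q := q) hq

/-- A baby Monster through `q` is either a prolongation, whose form is prolonged from below, or the
fibre through `q`, which takes the fibre covector. -/
theorem Coframe.nonempty_succ {N : Set (Fin (m + 1) → 𝕜)} {r k : ℕ}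
    {q : (monster 𝕜 m (k + 1)).Pt} (F : Coframe N r k (below q))
    (hq : q ∈ closure (tower N (k + 1))) : Nonempty (Coframe N r (k + 1) q) := by
  classical
  let old (S : Set (monster 𝕜 m (k + 1)).Pt) : Prop :=
    ∃ S', IsBabyMonster k S' ∧ S = prolongSet S'
  let form (B : (monster 𝕜 m k).E → (Fin (m + 1) → 𝕜)) :
      (monster 𝕜 m (k + 1)).E → (Fin (m + 1) → 𝕜) := prolongForm (M := monster 𝕜 m k) q B
  let val (B : (monster 𝕜 m k).E → (Fin (m + 1) → 𝕜)) : 𝕜 :=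
    form B (chartAt (monster 𝕜 m (k + 1)).E q q) (index (M := monster 𝕜 m k) q)
  have hform : ∀ B, form B (chartAt (monster 𝕜 m (k + 1)).E q q) =
      (index (M := monster 𝕜 m k) q).insertNth (α := fun _ => 𝕜) (val B)
        fun j => B (chartAt (monster 𝕜 m k).E (below q) (below q))
          ((index (M := monster 𝕜 m k) q).succAbove j) := by
    intro B
    ext j
    rcases Fin.eq_self_or_eq_succAbove (index (M := monster 𝕜 m k) q) j with rfl | ⟨i, rfl⟩
    · rw [Fin.insertNth_apply_same]
    · rw [Fin.insertNth_apply_succAbove]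
      exact Fin.insertNth_apply_succAbove (α := fun _ => 𝕜) _ _ _ _
  -- A set may be the prolongation of several baby Monsters; any choice serves.
  let baby (S : Set (monster 𝕜 m (k + 1)).Pt) : (monster 𝕜 m (k + 1)).E → (Fin (m + 1) → 𝕜) :=
    if h : old S then form (F.baby h.choose)
    else fun _ => Pi.single (index (M := monster 𝕜 m k) q) 1
  have hmem : ∀ {S} (h : old S), q ∈ S → q ∈ prolongSet h.choose := fun {S} h hS => by
    rw [← h.choose_spec.2]; exact hS
  have hfib : ∀ {S}, IsBabyMonster (k + 1) S → q ∈ S → ¬ old S →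
      S = {z | below z = below q} := fun hS hqS h => (eq_fiber_or_eq_prolongSet hS hqS).resolve_right h
  let g : {S // IsBabyMonster (k + 1) S ∧ q ∈ S} ⊕ Fin r →
      Option ({S // IsBabyMonster k S ∧ q ∈ prolongSet S} ⊕ Fin r) :=
    Sum.elim (fun S => if h : old S.1 then
      some (Sum.inl ⟨h.choose, h.choose_spec.1, hmem h S.2.2⟩) else none) fun i => some (Sum.inr i)
  -- A prolongation is recovered from the chosen baby Monster below it, and only the fibre through
  -- `q` can go to `none`.
  have hg : Function.Injective g := by
    rintro (⟨S, hS, hqS⟩ | i) (⟨T, hT, hqT⟩ | j) hST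
    · by_cases h1 : old S <;> by_cases h2 : old T <;>
        simp only [g, Sum.elim_inl, h1, h2, dite_true, dite_false, reduceCtorEq,
          Option.some.injEq, Sum.inl.injEq, Subtype.mk.injEq] at hST ⊢
      · rw [h1.choose_spec.2, h2.choose_spec.2, hST]
      · rw [hfib hS hqS h1, hfib hT hqT h2]
    · by_cases h1 : old S <;> simp [g, h1] at hST
    · by_cases h1 : old T <;> simp [g, h1] at hST
    · simpa [g] using hST
  refine ⟨⟨baby, fun i => form (F.sub i), fun S hS hqS => ?_,
    fun i => Annihilates.prolong (M := monster 𝕜 m k) (q := q) (F.sub_annihilates i), ?_⟩⟩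
  · by_cases h : old S
    · have h1 := Annihilates.prolong (M := monster 𝕜 m k) (q := q)
        (F.baby_annihilates h.choose h.choose_spec.1 (hmem h hqS).1)
      have h2 : baby S = form (F.baby h.choose) := dif_pos h
      rw [h2]
      rw [← h.choose_spec.2] at h1
      exact h1
    · have h2 : baby S = fun _ => Pi.single (index (M := monster 𝕜 m k) q) 1 := dif_neg h
      rw [h2, hfib hS hqS h]
      exact annihilates_fiber (M := monster 𝕜 m k) q
  · have := (F.linearIndependent_option hq (Sum.elim (fun S => val (F.baby S.1))
      fun i => val (F.sub i))).comp g hg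
    convert this using 1
    funext i
    rcases i with ⟨S, hS, hqS⟩ | i
    · by_cases h : old S
      · simp only [Sum.elim_inl, Function.comp, g, baby, h, dite_true, Option.elim, hform]
      · simp only [Sum.elim_inl, Function.comp, g, baby, h, dite_false, Option.elim]
    · simp only [Sum.elim_inr, Function.comp, g, Option.elim, hform]

/-- At level `0` there are no baby Monsters, and the forms are the differentials of the last `m + 1
- e` straightening coordinates at `x`. Membership of `p` in the closure suffices to climb, and
`root` keeps track of where `N` is straightened. -/
theorem nonempty_coframe {e : ℕ} {N : Set (Fin (m + 1) → 𝕜)}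
    (hN : IsAnalyticSubmanifold e N) {x : Fin (m + 1) → 𝕜} (hx : x ∈ N) :
    ∀ (k : ℕ) (p : (monster 𝕜 m k).Pt), p ∈ closure (tower N k) → root k p = x →
      Nonempty (Coframe N (m + 1 - e) k p)
  | 0, p, _, hp => by
    obtain ⟨φ, hxφ, h1, h2, h3⟩ := hN x hx
    replace hp : p = x := hp
    subst hp
    have hno : ∀ S : Set (monster 𝕜 m 0).Pt, ¬ IsBabyMonster 0 S := fun S hS => by cases hS
    let ι (i : Fin (m + 1 - e)) : Fin (m + 1) := ⟨e + i, by omega⟩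
    refine ⟨⟨fun _ _ => 0, fun i y j => fderiv 𝕜 φ y (Pi.single j 1) (ι i),
      fun S hS => (hno S hS).elim,
      fun i => annihilates_submanifold h1 h3 hxφ (Nat.le_add_right e i), ?_⟩⟩
    have := (linearIndependent_fderiv h1 h2 hxφ).comp
      (Sum.elim (fun S : {S // IsBabyMonster 0 S ∧ p ∈ S} => (hno _ S.2.1).elim) ι) (by
        rintro (⟨S, hS, _⟩ | i) (⟨T, hT, _⟩ | j) h
        · exact (hno S hS).elim
        · exact (hno S hS).elim
        · exact (hno T hT).elim
        · simpa [ι, Fin.ext_iff] using h)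
    convert this using 1
    funext i
    rcases i with ⟨S, hS, _⟩ | i
    · exact (hno S hS).elim
    · rfl
  | k + 1, q, hq, hqx => by
    obtain ⟨F⟩ := nonempty_coframe hN hx k (below q)
      (map_mem_closure continuous_below hq fun z hz => hz.1) hqx
    exact F.nonempty_succ hq

end monster

/-- The infimum is attained because the whole space shows that the set of dimensions is nonempty. -/
theorem exists_submanifold_of_embeddingDim {𝕜 : Type u} [RCLike 𝕜] {n : ℕ}
    (γ : 𝕜 → (Fin n → 𝕜)) :
    ∃ S : Set (Fin n → 𝕜), IsAnalyticSubmanifold (embeddingDim γ) S ∧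
      ∀ᶠ t in 𝓝 (0 : 𝕜), γ t ∈ S :=
  Nat.sInf_mem (s := {d | ∃ S : Set (Fin n → 𝕜), IsAnalyticSubmanifold d S ∧
    ∀ᶠ t in 𝓝 (0 : 𝕜), γ t ∈ S}) ⟨n, Set.univ, fun x _ =>
      ⟨OpenPartialHomeomorph.refl _, trivial, contDiffOn_id, contDiffOn_id, fun y _ =>
        ⟨fun _ i hi => absurd i.2 (by omega), fun _ => trivial⟩⟩,
      Filter.Eventually.of_forall fun _ => trivial⟩

end

/-! ### The dimension count at `ζ`. -/

theorem mainTheorem8 {𝕜 : Type*} [RCLike 𝕜] (m k d : ℕ) (hd : 1 ≤ d)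
    (ζ : (monster 𝕜 m (k + 1)).Pt)
    (C : Finset (Submodule 𝕜 (monster 𝕜 m k).E)) (hC : C.card = d - 1)
    (hcrit : ∀ H ∈ C, monster.IsCriticalHyperplane (monster.below ζ) H)
    (hline : ∀ H ∈ C, monster.line ζ ≤ H) :
    ¬ ∃ γ : 𝕜 → (Fin (m + 1) → 𝕜), AnalyticAt 𝕜 γ 0 ∧ embeddingDim γ < d ∧
      monster.ReachedBy ζ γ := by
  rintro ⟨γ, hγ, hed, c, h0, hc, rfl⟩
  obtain ⟨N, hN, hγN⟩ := exists_submanifold_of_embeddingDim γ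
  have hev := monster.eventually_mem_tower hγ hγN h0 hc (k + 1) le_rfl
  have hcont : Filter.Tendsto (c (k + 1)) (𝓝[≠] 0) (𝓝 (c (k + 1) 0)) :=
    (hc k (Nat.lt_succ_self k)).2.tendsto.mono_left nhdsWithin_le_nhds
  have hcl : c (k + 1) 0 ∈ closure (monster.tower N (k + 1)) :=
    mem_closure_of_tendsto hcont (hev.mono fun t ht => ht.2.1)
  -- `IsProlongation` prescribes base points only for `t ≠ 0`, so the base point over `0` is found
  -- as a limit.
  have hroot : monster.root (k + 1) (c (k + 1) 0) = γ 0 :=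
    tendsto_nhds_unique (((monster.continuous_root (k + 1)).tendsto _).comp hcont)
      ((hγ.continuousAt.tendsto.mono_left nhdsWithin_le_nhds).congr'
        (hev.mono fun t ht => ht.2.2.symm))
  obtain ⟨F⟩ := monster.nonempty_coframe hN hγN.self_of_nhds k (monster.below (c (k + 1) 0))
    (map_mem_closure monster.continuous_below hcl fun z hz => hz.1) hroot
  choose S hS hpS hHS using hcrit
  -- Since `ℓ` lies in each hyperplane of `C`, it is tangent to the corresponding baby Monster.
  let g : C ⊕ Fin (m + 1 - embeddingDim γ) →
      {S // monster.IsBabyMonster k S ∧ c (k + 1) 0 ∈ DistManifold.prolongSet S} ⊕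
        Fin (m + 1 - embeddingDim γ) :=
    Sum.map (fun H => ⟨S H.1 H.2, hS H.1 H.2, hpS H.1 H.2,
      ((hline H.1 H.2).trans (hHS H.1 H.2).le).trans inf_le_right⟩) id
  -- Each hyperplane is determined by its baby Monster, so distinct hyperplanes come from distinct
  -- ones.
  have hg : Function.Injective g := Sum.map_injective.2 ⟨fun H H' h => Subtype.ext (by
    rw [hHS H.1 H.2, hHS H'.1 H'.2, show S H.1 H.2 = S H'.1 H'.2 from Subtype.mk.inj h]), Function.injective_id⟩
  have hcard := ((F.linearIndependent_option hcl fun _ => 0).comp (Option.map g)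
    (Option.map_injective hg)).fintype_card_le_finrank
  simp only [Fintype.card_option, Fintype.card_sum, Fintype.card_coe, Fintype.card_fin,
    Module.finrank_fin_fun, hC] at hcard
  -- The bound reads `(d - 1) + (m + 1 - e) + 1 ≤ m + 1`, the last summand on the left being the
  -- fibre covector; it contradicts `e < d`, even where the subtraction truncates.
  omega
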